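/- **Setting.** Let $\Lambda$ be a finite connected triangulated closed oriented surface with vertex set $V$, edges $E$ directed by a branching structure (no loops), and triangles $\Delta$ with vertices $1\to2\to3$ and orientation sign $s(\Delta)=\pm1$; every edge lies on exactly two triangles, which induce opposite orientations on it. Let $G$ be a finite solvable group and $\omega:G^3\to U(1)$ a 3-cocycle. The $G$-SPT state on $\mathbb C[G]^{\otimes V}$ is $|\Psi_{\rm SPT}\rangle=\sum_{\{g_v\}}\prod_{\Delta}\omega(g_3g_2^{-1},g_2g_1^{-1},g_1)^{s(\Delta)}\,|\{g_v\}\rangle$. States are not normalized. Fix subgroups $1=G_0\le G_1\le\dots\le G_N=G$ with $G_{k-1}\trianglelefteq G_k$ and $Q_k=G_k/G_{k-1}$ abelian, isomorphisms $Q_k\cong\prod_{j}\mathbb Z_{d_k^j}$, and sections $s_k:Q_k\to G_k$ with $s_k(1)=1$. Every $g\in G$ is uniquely $g=q_N\cdots q_1$ with $q_k=q_k(g)\in s_k(Q_k)$; put $n_k(g)=q_k\cdots q_1\in G_k$. For $p\in\prod_j\mathbb Z_{d_k^j}$ let $z_k^{p}(g)=\prod_j e^{2\pi i\,p_ja_j/d_k^j}$,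 where $a$ are the coordinates of the class of $q_k(g)$, let $Z_k^p|g\rangle=z_k^p(g)|g\rangle$, and let the Fourier state with label $p$ of the $k$-th factor be $Z_k^p|+\rangle$, where $|+\rangle$ is the uniform superposition of the values of $q_k$. **Procedure.** Put $|1\rangle$ on every edge. In round $k=1,\dots,N$: (1) apply to every edge $j\to i$ the controlled shift $|g_i,g_j\rangle|h\rangle\mapsto|g_i,g_j\rangle|q_k(g_i)\,h\,q_k(g_j)^{-1}\rangle$; (2) measure the $k$-th factor of every vertex in the Fourier basis, with outcomes $p_v^{(k)}\in\prod_j\mathbb Z_{d_k^j}$; (3) choose a base vertex $b_k$ and for each vertex $v$ a path from $b_k$ to $v$, and for each $v$ apply along its path the string of operators $Z_k^{p_v^{(k)}}$ on edges traversed forwards and $Z_k^{-p_v^{(k)}}$ on edges traversed backwards. **Gauged states.** For a subgroup $K\le G$ with a choice of representatives $q$ of the cosets $gK$, write $g=qn$ with $n\in K$, and let $\Gamma_K|\{g_v\}\rangle=|\{q_v\}\rangle_V\otimes|\{n_in_j^{-1}\}\rangle_E$ over edges $j\to i$; for $K=G_k$ take $q=q_N\cdots q_{k+1}$. Let $\Gamma|\{g_v\}\rangle=|\{g_ig_j^{-1}\}\rangle_E$.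 For edge labels $h$ and $x\in G$, let $W_v^x(h)$ be the product of the 3-cocycles (with orientation signs) of the tetrahedra spanned by the triangles at $v$ and a lift $v'$ of $v$ with $v\to v'$ labelled by $x$, when these triangles are flat, i.e. $h_{32}h_{21}=h_{31}$; let $W_v^x(h)=1$ otherwise. Let $\prod_{e\ni v}L^x_{\pm e}$ multiply the edges flowing to $v$ by $x$ on the left and those emanating from $v$ by $x^{-1}$ on the right. The twisted quantum double $D^\omega(G)$ has $H_{\rm TQD}=-\sum_vA_v-\sum_pB_p$ with $A_v=\frac1{|G|}\sum_{x\in G}(\prod_{e\ni v}L^x_{\pm e})W_v^x$ and $B_p$ the projector onto flat $p$. The $K$-gauged (SET) Hamiltonian is $H_K=-\sum_vA_v-\sum_pB_p-\sum_vK_v$, where $W$ is evaluated on $h_e=q_in_eq_j^{-1}$, $A_v=\frac1{|K|}\sum_{n\in K}\sum_{q}(\prod_{e\ni v}L^n_{\pm e})W_v^{qnq^{-1}}|q\rangle_v\langle q|$, $B_p$ is the projector onto flat $n$ at $p$, and $K_v$ has matrix element $\frac1{[G:K]}W_v^{q'q^{-1}}(h)$, with $h$ the labels of the initial configuration, from a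 configuration with $q_v=q$ to the one with $q_v=q'$ that agrees with it elsewhere. **Theorem.** Such series exist, and for each series the required isomorphisms and sections exist. For all such choices: 1. *(Transmutation rule.)* $z_k^p(g)=z_k^p(h)\,z_k^p\big(n_k(g)n_k(h)^{-1}\big)$ for all $g,h\in G$, $1\le k\le N$; and all the $Z$-string operators commute. 2. *(Global constraint.)* For all choices of base vertices and paths, the state after the measurement of round $k$ is nonzero (the outcomes are possible) if and only if $\sum_{v}p_v^{(j)}=0$ in $\prod_i\mathbb Z_{d_j^i}$ for every $j\le k$. 3. *(Correction and intermediate states.)* If $\sum_v p^{(j)}_v=0$ for all $j\le k$, then for all choices of base vertices and paths the state after $k\le N$ rounds is a nonzero multiple of the state in which the factors $q_1,\dots,q_k$ of each vertex are in the measured Fourier states and the remaining degrees of freedom are in the state $\Gamma_{G_k}|\Psi_{\rm SPT}\rangle$. So all random charge factors are removed. 4. *(SET ground states.)* For each $k\le N$, $\Gamma_{G_k}|\Psi_{\rm SPT}\rangle$ is a ground state of $H_{G_k}$. It is invariant under the remaining global symmetry, namely, for each $x$ in the normalizer of $G_k$ (all of $G$ if $G_k\trianglelefteq G$), under the operator $|\{q_v\},\{n_e\}\rangle\mapsto|\{q'_v\},\{m_i\,xn_ex^{-1}\,m_j^{-1}\}\rangle$,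 where $q_vx^{-1}=q'_vm_v$ with $q'_v$ a coset representative and $m_v\in G_k$. 5. *(Final state.)* If all constraints hold, the state after $N$ rounds is a nonzero multiple of (measured Fourier states on the vertices) $\otimes\ \Gamma|\Psi_{\rm SPT}\rangle$, and $\Gamma|\Psi_{\rm SPT}\rangle$ is a ground state of the twisted quantum double Hamiltonian $H_{\rm TQD}$ of $D^\omega(G)$. -/

import Mathlib

open scoped Classical
open Matrix

/-! ## The lattice -/

/-- A finite family of directed edges `E` on vertices `V`, without loops. -/
structure DirectedLattice (V E : Type*) where
  src : E → V
  tgt : E → V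
  loopless : ∀ e, src e ≠ tgt e

/-- Edge paths from `b`, whose edges may be traversed along or against their direction. -/
inductive DirectedLattice.EdgePath {V E : Type*} (L : DirectedLattice V E) (b : V) : V → Type _
  | nil : EdgePath L b b
  | forward (e : E) (γ : EdgePath L b (L.src e)) : EdgePath L b (L.tgt e)
  | backward (e : E) (γ : EdgePath L b (L.tgt e)) : EdgePath L b (L.src e)

/-- A connected closed oriented triangulated surface with a branching structure.  A triangle `f`
has vertices `1 → 2 → 3` and edges `bd f 0 = (1 → 2)`, `bd f 1 = (2 → 3)`, `bd f 2 = (1 → 3)`; the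
sign `sgn f` compares the orientation `1 → 2 → 3` with that of the surface.  Every edge lies on
exactly two triangles, which induce opposite orientations on it. -/
structure TriangulatedSurface (V E F : Type*) extends DirectedLattice V E where
  bd : F → Fin 3 → E
  src_eq : ∀ f, src (bd f 2) = src (bd f 0)
  mid_eq : ∀ f, src (bd f 1) = tgt (bd f 0)
  tgt_eq : ∀ f, tgt (bd f 2) = tgt (bd f 1)
  sgn : F → ℤˣ
  closed : ∀ e, ∃ a b : F × Fin 3, a ≠ b ∧ (∀ c : F × Fin 3, bd c.1 c.2 = e ↔ c = a ∨ c = b) ∧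
    sgn a.1 * (![1, 1, -1] : Fin 3 → ℤˣ) a.2 = -(sgn b.1 * (![1, 1, -1] : Fin 3 → ℤˣ) b.2)
  connected : ∀ v w, Nonempty (toDirectedLattice.EdgePath v w)

/-! ## Group-theoretic input -/

/-- A series `1 = G_0 ≤ G_1 ≤ ⋯ ≤ G_N = G` with `G_k` normal in `G_{k+1}` and abelian quotients.
The subgroups are indexed by `ℕ`; those beyond `N` are all equal to `G`. -/
structure AbelianSeries (G : Type*) [Group G] where
  length : ℕ
  sub : ℕ → Subgroup G
  mono : Monotone sub
  sub_zero : sub 0 = ⊥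
  sub_length : sub length = ⊤
  normal : ∀ k, ((sub k).subgroupOf (sub (k + 1))).Normal
  comm : ∀ k, ∀ a b : sub (k + 1) ⧸ (sub k).subgroupOf (sub (k + 1)), a * b = b * a

attribute [instance] AbelianSeries.normal

/-- The quotient `G_{k+1} / G_k`. -/
abbrev AbelianSeries.Q {G : Type*} [Group G] (A : AbelianSeries G) (k : ℕ) : Type _ :=
  A.sub (k + 1) ⧸ (A.sub k).subgroupOf (A.sub (k + 1))

/-- The choices made in the procedure: coordinates `G_{k+1}/G_k ≅ ∏_j ℤ/d_j` and set-theoretic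
sections (embeddings) `G_{k+1}/G_k → G_{k+1}` that preserve the identity. -/
structure AbelianSeries.Embedding {G : Type*} [Group G] (A : AbelianSeries G) where
  rank : ℕ → ℕ
  ord : (k : ℕ) → Fin (rank k) → ℕ
  ord_ne : ∀ k j, NeZero (ord k j)
  coord : ∀ k, A.Q k ≃* Multiplicative (∀ j : Fin (rank k), ZMod (ord k j))
  sec : ∀ k, A.Q k → A.sub (k + 1)
  sec_spec : ∀ k (q : A.Q k), (QuotientGroup.mk (sec k q) : A.Q k) = q
  sec_one : ∀ k, sec k 1 = 1

attribute [instance] AbelianSeries.Embedding.ord_ne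

/-- A 3-cocycle on `G` with values in `U(1)`. -/
def IsThreeCocycle {G : Type*} [Group G] (ω : G → G → G → Circle) : Prop :=
  ∀ g h k l : G, ω h k l * ω g (h * k) l * ω g h k = ω (g * h) k l * ω g h (k * l)

/-- `ψ` is a ground state of the Hamiltonian `H`: an eigenvector for the lowest eigenvalue. -/
def IsGroundState {C : Type*} [Fintype C] (H : Matrix C C ℂ) (ψ : C → ℂ) : Prop :=
  H.IsHermitian ∧ ψ ≠ 0 ∧ ∃ E₀ : ℝ, H *ᵥ ψ = (E₀ : ℂ) • ψ ∧
    ∀ φ : C → ℂ, E₀ * (star φ ⬝ᵥ φ).re ≤ (star φ ⬝ᵥ (H *ᵥ φ)).re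

noncomputable section

namespace AbelianSeries.Embedding

variable {G : Type*} [Group G] {A : AbelianSeries G} (S : A.Embedding)

/-- The representative, in the image of the `k`-th section, of the class of `x ∈ G_{k+1}`. -/
def rep (k : ℕ) (x : G) : G :=
  if hx : x ∈ A.sub (k + 1) then (S.sec k (QuotientGroup.mk ⟨x, hx⟩) : G) else 1

/-- What is left of `g = q_N ⋯ q_1` when the first `m` factors `q_N, …, q_{N-m+1}` are removed. -/
def strip : ℕ → G → G
  | 0, g => g
  | m + 1, g => (S.rep (A.length - (m + 1)) (strip m g))⁻¹ * strip m g

/-- The part `q_k ⋯ q_1 ∈ G_k` of `g = q_N ⋯ q_1`. -/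
def low (k : ℕ) (g : G) : G := S.strip (A.length - k) g

/-- The part `q_N ⋯ q_{k+1}` of `g = q_N ⋯ q_1`. -/
def high (k : ℕ) (g : G) : G := g * (S.low k g)⁻¹

lemma rep_inv_mul_mem (k : ℕ) {x : G} (hx : x ∈ A.sub (k + 1)) :
    (S.rep k x)⁻¹ * x ∈ A.sub k := by
  have h := S.sec_spec k (QuotientGroup.mk ⟨x, hx⟩)
  rw [QuotientGroup.eq] at h
  simpa [rep, hx, Subgroup.mem_subgroupOf] using h

lemma strip_mem (m : ℕ) (hm : m ≤ A.length) (g : G) : S.strip m g ∈ A.sub (A.length - m) := by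
  induction m with
  | zero => simp [A.sub_length]
  | succ m ih =>
    have h := ih (by omega)
    have e : A.length - m = A.length - (m + 1) + 1 := by omega
    rw [e] at h
    exact S.rep_inv_mul_mem _ h

lemma low_mem (k : ℕ) (g : G) : S.low k g ∈ A.sub k :=
  A.mono (by omega : A.length - (A.length - k) ≤ k) |> fun h => by
    by_cases hk : k ≤ A.length
    · exact h (S.strip_mem _ (by omega) g)
    · have : A.sub k = ⊤ := top_le_iff.1 (A.sub_length ▸ A.mono (by omega : A.length ≤ k))
      simp [this]

/-- The class in `G_{k+1}/G_k` of the factor `q_{k+1}` of `g = q_N ⋯ q_1`. -/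
def cls (k : ℕ) (g : G) : A.Q k := QuotientGroup.mk ⟨S.low (k + 1) g, S.low_mem (k + 1) g⟩

/-- The factor `q_{k+1}` of `g = q_N ⋯ q_1`. -/
def digit (k : ℕ) (g : G) : G := S.sec k (S.cls k g)

lemma low_succ {k : ℕ} (hk : k < A.length) (g : G) :
    S.low (k + 1) g = S.digit k g * S.low k g := by
  have e1 : A.length - k = (A.length - (k + 1)) + 1 := by omega
  have e2 : A.length - (A.length - (k + 1) + 1) = k := by omega
  have hm := S.low_mem (k + 1) g
  have e3 : S.low k g = (S.rep k (S.low (k + 1) g))⁻¹ * S.low (k + 1) g := by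
    simp only [low]
    rw [e1]
    simp only [strip]
    rw [e2]
  rw [e3]
  simp [rep, hm, digit, cls]

/-- `g = q_N ⋯ q_2 q_1`. -/
lemma prod_digit (g : G) : ((List.range A.length).reverse.map fun k => S.digit k g).prod = g := by
  have key : ∀ k ≤ A.length,
      ((List.range k).reverse.map fun k => S.digit k g).prod = S.low k g := by
    intro k
    induction k with
    | zero =>
      intro _
      have h := S.low_mem 0 g
      rw [A.sub_zero, Subgroup.mem_bot] at h
      simp [h]
    | succ k ih =>
      intro hk
      rw [S.low_succ (by omega) g, ← ih (by omega)]
      simp [List.range_succ]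
  simpa [low, strip] using key A.length le_rfl

/-- The representative `q_N ⋯ q_{k+1}` of a coset `g G_k`. -/
def cosetRep (k : ℕ) (c : G ⧸ A.sub k) : G := S.high k c.out

lemma strip_mul (k m : ℕ) (hm : m + k ≤ A.length) (g x : G) (hx : x ∈ A.sub k) :
    S.strip m (g * x) = S.strip m g * x := by
  induction m with
  | zero => rfl
  | succ m ih =>
    have h1 := ih (by omega)
    have h := S.strip_mem m (by omega) g
    have e : A.length - m = A.length - (m + 1) + 1 := by omega
    rw [e] at h
    have hx1 : x ∈ A.sub (A.length - (m + 1)) := A.mono (by omega) hx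
    have hx2 : x ∈ A.sub (A.length - (m + 1) + 1) := A.mono (by omega) hx
    have hr : S.rep (A.length - (m + 1)) (S.strip m g * x)
        = S.rep (A.length - (m + 1)) (S.strip m g) := by
      have hq : (QuotientGroup.mk ⟨S.strip m g * x, mul_mem h hx2⟩ : A.Q (A.length - (m + 1)))
          = QuotientGroup.mk ⟨S.strip m g, h⟩ := by
        rw [eq_comm, QuotientGroup.eq]
        simpa [Subgroup.mem_subgroupOf] using hx1
      simp only [rep, h, mul_mem h hx2, dif_pos]
      rw [hq]
    simp only [strip, h1, hr, mul_assoc]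

/-- `cosetRep` is the part `q_N ⋯ q_{k+1}` of every member of the coset. -/
lemma cosetRep_mk (k : ℕ) (hk : k ≤ A.length) (g : G) :
    S.cosetRep k (QuotientGroup.mk g) = S.high k g := by
  obtain ⟨x, hx⟩ := QuotientGroup.mk_out_eq_mul (A.sub k) g
  simp only [cosetRep, high, low]
  rw [hx, S.strip_mul k _ (by omega) g x x.2]
  group

/-- Labels `(i_1, …, i_l)` of the Fourier basis of the `k`-th quotient. -/
abbrev Charge (k : ℕ) : Type := ∀ j : Fin (S.rank k), ZMod (S.ord k j)

/-- The eigenvalue of `Z_1^{i_1} ⋯ Z_l^{i_l}` (for the `k`-th quotient) on the basis state `|g⟩`: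
the product of `exp (2π i · i_j a_j / d_j)`, with `a` the coordinates of the `k`-th factor. -/
def zPhase (k : ℕ) (i : S.Charge k) (g : G) : ℂ :=
  ∏ j, ZMod.stdAddChar (i j * Multiplicative.toAdd (S.coord k (S.cls k g)) j)

/-- The amplitudes of the normalised Fourier state `Z_1^{i_1} ⋯ Z_l^{i_l} |+⟩`. -/
def fourier (k : ℕ) (i : S.Charge k) (g : G) : ℂ :=
  S.zPhase k i g / (Real.sqrt (Nat.card (A.Q k)) : ℂ)

end AbelianSeries.Embedding

/-! ## States and Hamiltonians -/

namespace TriangulatedSurface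

variable {G : Type*} [Group G] [Fintype G] {V E F : Type*} [Fintype V] [Fintype E] [Fintype F]
variable (L : TriangulatedSurface V E F) (ω : G → G → G → Circle)

def v1 (f : F) : V := L.src (L.bd f 0)
def v2 (f : F) : V := L.tgt (L.bd f 0)
def v3 (f : F) : V := L.tgt (L.bd f 1)

/-- The fixed-point SPT state. -/
def spt (g : V → G) : ℂ :=
  ∏ f, ((ω (g (L.v3 f) * (g (L.v2 f))⁻¹) (g (L.v2 f) * (g (L.v1 f))⁻¹) (g (L.v1 f)) ^
    (L.sgn f : ℤ) : Circle) : ℂ)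

/-- No flux through the triangle `f`. -/
def Flat {M : Type*} [Group M] (h : E → M) (f : F) : Prop :=
  h (L.bd f 1) * h (L.bd f 0) = h (L.bd f 2)

/-- `∏_{e ∋ v} L^x_{±e}`: left multiplication by `x` on edges flowing to `v`, right multiplication
by `x⁻¹` on edges emanating from `v`. -/
def shift {M : Type*} [Group M] (v : V) (x : M) (h : E → M) : E → M := fun e =>
  if L.tgt e = v then x * h e else if L.src e = v then h e * x⁻¹ else h e

/-- The cocycle of the tetrahedron spanned by the triangle `f` and the lift `v'` of its vertex `v`,
where `v → v'` carries `x`; it is `1` if `v` is not a vertex of `f`. -/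
def tetra (v : V) (x : G) (h : E → G) (f : F) : Circle :=
  if v = L.v3 f then ω x (h (L.bd f 1)) (h (L.bd f 0)) ^ (L.sgn f : ℤ)
  else if v = L.v2 f then ω (h (L.bd f 1) * x⁻¹) x (h (L.bd f 0)) ^ (-(L.sgn f : ℤ))
  else if v = L.v1 f then ω (h (L.bd f 1)) (h (L.bd f 0) * x⁻¹) x ^ (L.sgn f : ℤ)
  else 1

/-- The phase `W_v^x`: the product of the cocycles of the tetrahedra of the prism over the
triangles at `v`.  These tetrahedra carry consistent labels only if the triangles at `v` have no
flux; on the other configurations the phase is set to `1`. -/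
def W (v : V) (x : G) (h : E → G) : ℂ :=
  if ∀ f, (v = L.v1 f ∨ v = L.v2 f ∨ v = L.v3 f) → L.Flat h f then
    ((∏ f, L.tetra ω v x h f : Circle) : ℂ) else 1

/-- Gauging map of the whole group, `|{g_v}⟩ ↦ |{g_i g_j⁻¹}⟩` for edges `j → i`. -/
def gaugingMap : Matrix (E → G) (V → G) ℂ := fun h g =>
  if ∀ e, h e = g (L.tgt e) * (g (L.src e))⁻¹ then 1 else 0

/-- The vertex term of the twisted quantum double. -/
def tqdA (v : V) : Matrix (E → G) (E → G) ℂ := fun h' h =>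
  (Fintype.card G : ℂ)⁻¹ * ∑ x : G, if h' = L.shift v x h then L.W ω v x h else 0

/-- The plaquette term of the twisted quantum double. -/
def tqdB (f : F) : Matrix (E → G) (E → G) ℂ := Matrix.diagonal fun h => if L.Flat h f then 1 else 0

/-- The Hamiltonian of the twisted quantum double `D^ω(G)`. -/
def tqdHamiltonian : Matrix (E → G) (E → G) ℂ := -∑ v, L.tqdA ω v - ∑ f, L.tqdB f

section Subgroup

variable (K : Subgroup G) (σ : G ⧸ K → G)

/-- Basis labels after gauging `K`: cosets on vertices, elements of `K` on edges. -/
abbrev SetConfig (V E : Type*) (K : Subgroup G) : Type _ := (V → G ⧸ K) × (E → K)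

/-- The part `n ∈ K` of `g = q n`, where `q = σ (g K)`. -/
def normalPart (g : G) : G := (σ (QuotientGroup.mk g))⁻¹ * g

/-- Gauging map of the subgroup `K`, `|{g_v}⟩ ↦ |{q_v}⟩ ⊗ |{n_i n_j⁻¹}⟩` for edges `j → i`. -/
def subgroupGaugingMap : Matrix (SetConfig V E K) (V → G) ℂ := fun c g =>
  if (∀ v, c.1 v = QuotientGroup.mk (g v)) ∧
    ∀ e, (c.2 e : G) = normalPart K σ (g (L.tgt e)) * (normalPart K σ (g (L.src e)))⁻¹
  then 1 else 0

/-- The `G`-valued edge labels `q_i n_e q_j⁻¹`. -/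
def edgeLabel (c : SetConfig V E K) (e : E) : G :=
  σ (c.1 (L.tgt e)) * c.2 e * (σ (c.1 (L.src e)))⁻¹

/-- The vertex term `A_v` after gauging `K`. -/
def setA (v : V) : Matrix (SetConfig V E K) (SetConfig V E K) ℂ := fun c' c =>
  (Fintype.card K : ℂ)⁻¹ * ∑ n : K, if c'.1 = c.1 ∧ c'.2 = L.shift v n c.2 then
    L.W ω v (σ (c.1 v) * n * (σ (c.1 v))⁻¹) (L.edgeLabel K σ c) else 0

/-- The plaquette term `B_p` after gauging `K`. -/
def setB (f : F) : Matrix (SetConfig V E K) (SetConfig V E K) ℂ :=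
  Matrix.diagonal fun c => if L.Flat c.2 f then 1 else 0

/-- The additional vertex term `K_v = m⁻¹ ∑_{k,l} W_v^{q_k q_l⁻¹} |q_k⟩⟨q_l|`, `m = |G / K|`. -/
def setK (v : V) : Matrix (SetConfig V E K) (SetConfig V E K) ℂ := fun c' c =>
  (Fintype.card (G ⧸ K) : ℂ)⁻¹ * if (∀ w, w ≠ v → c'.1 w = c.1 w) ∧ c'.2 = c.2 then
    L.W ω v (σ (c'.1 v) * (σ (c.1 v))⁻¹) (L.edgeLabel K σ c) else 0

/-- The Hamiltonian of the symmetry-enriched phase obtained by gauging `K`. -/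
def setHamiltonian : Matrix (SetConfig V E K) (SetConfig V E K) ℂ :=
  -∑ v, L.setA ω K σ v - ∑ f, L.setB K f - ∑ v, L.setK ω K σ v

/-- The remaining global symmetry for `x` in the normaliser of `K`: right action `g ↦ g x⁻¹` on all
vertices and conjugation by `x` on all edges.  The right action sends `q_v` to `q'_v m_v` with
`m_v ∈ K`, which need not be `1` when the section is not a homomorphism; the factor `m_v` is moved
to the edges at `v`. -/
def symmetry (x : G) : Matrix (SetConfig V E K) (SetConfig V E K) ℂ := fun c' c =>
  if (∀ v, c'.1 v = QuotientGroup.mk (σ (c.1 v) * x⁻¹)) ∧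
    ∀ e, (c'.2 e : G) =
      normalPart K σ (σ (c.1 (L.tgt e)) * x⁻¹) * (x * c.2 e * x⁻¹) *
        (normalPart K σ (σ (c.1 (L.src e)) * x⁻¹))⁻¹
  then 1 else 0

end Subgroup

/-! ## The measurement-based procedure -/

section Procedure

variable {A : AbelianSeries G} (S : A.Embedding)

/-- Basis labels of the full Hilbert space: `G` on every vertex and every edge. -/
abbrev Config (V E G : Type*) : Type _ := (V → G) × (E → G)

/-- The SPT state with ancillas in the state `|1⟩` on all edges. -/
def initial : Config V E G → ℂ := fun c => if c.2 = 1 then L.spt ω c.1 else 0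

/-- The controlled shift `|g_1, g_2⟩⟨g_1, g_2| ⊗ |q(g_1) g_3 q(g_2)⁻¹⟩⟨g_3|` on an edge `2 → 1`,
with `q` the `k`-th factor. -/
def gate (k : ℕ) (e : E) : Matrix (Config V E G) (Config V E G) ℂ := fun c' c =>
  if c'.1 = c.1 ∧ c'.2 = Function.update c.2 e
    (S.digit k (c.1 (L.tgt e)) * c.2 e * (S.digit k (c.1 (L.src e)))⁻¹) then 1 else 0

/-- The controlled shifts on all edges (they commute, so their order is irrelevant). -/
def entangle (k : ℕ) : Matrix (Config V E G) (Config V E G) ℂ :=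
  ((Finset.univ : Finset E).toList.map (L.gate S k)).prod

/-- The projector onto the Fourier state with label `i` of the `k`-th factor at the vertex `v`. -/
def proj (k : ℕ) (v : V) (i : S.Charge k) : Matrix (Config V E G) (Config V E G) ℂ := fun c' c =>
  if c'.2 = c.2 ∧ (∀ w, w ≠ v → c'.1 w = c.1 w) ∧
      (∀ j < A.length, j ≠ k → S.cls j (c'.1 v) = S.cls j (c.1 v)) then
    S.fourier k i (c'.1 v) * star (S.fourier k i (c.1 v)) else 0

/-- The measurement of the `k`-th factor at all vertices, with outcomes `p`. -/
def measure (k : ℕ) (p : V → S.Charge k) : Matrix (Config V E G) (Config V E G) ℂ :=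
  ((Finset.univ : Finset V).toList.map fun v => proj S k v (p v)).prod

/-- The operator `Z_1^{i_1} ⋯ Z_l^{i_l}` for the `k`-th factor on the edge `e`. -/
def zEdge (V : Type*) {E : Type*} [Fintype V] [Fintype E] (k : ℕ) (i : S.Charge k) (e : E) :
    Matrix (Config V E G) (Config V E G) ℂ :=
  Matrix.diagonal fun c => S.zPhase k i (c.2 e)

/-- The string of `Z`-operators of charge `i` along a path. -/
def zString (k : ℕ) (i : S.Charge k) {b : V} :
    {v : V} → L.EdgePath b v → Matrix (Config V E G) (Config V E G) ℂ
  | _, .nil => 1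
  | _, .forward e γ => zEdge S V k i e * zString k i γ
  | _, .backward e γ => zEdge S V k (-i) e * zString k i γ

/-- The correction for the outcomes `p`: strings of `Z`-operators that join every vertex `v` to one
base vertex `b`, with charge `p v`. -/
def correct (k : ℕ) (p : V → S.Charge k) {b : V} (γ : ∀ v, L.EdgePath b v) :
    Matrix (Config V E G) (Config V E G) ℂ :=
  ((Finset.univ : Finset V).toList.map fun v => L.zString S k (p v) (γ v)).prod

/-- The (unnormalised) state after `k` rounds with outcomes `p`, the correction strings of every
round being chosen as `γ`. -/
def run (p : ∀ k, V → S.Charge k) {b : ℕ → V} (γ : ∀ k v, L.EdgePath (b k) v) :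
    ℕ → Config V E G → ℂ
  | 0 => L.initial ω
  | k + 1 => L.correct S k (p k) (γ k) *ᵥ (measure S k (p k) *ᵥ (L.entangle S k *ᵥ run p γ k))

/-- The state right after the measurement of round `k + 1`. -/
def postMeasure (p : ∀ k, V → S.Charge k) {b : ℕ → V} (γ : ∀ k v, L.EdgePath (b k) v) (k : ℕ) :
    Config V E G → ℂ :=
  measure S k (p k) *ᵥ (L.entangle S k *ᵥ L.run ω S p γ k)

/-- The product, over all vertices, of the Fourier states of the first `k` factors. -/
def measured (k : ℕ) (p : ∀ k, V → S.Charge k) (g : V → G) : ℂ :=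
  ∏ v, ∏ j ∈ Finset.range k, S.fourier j (p j v) (g v)

/-- The state of the full system in which the first `k` factors at every vertex are in the measured
Fourier states and the remaining degrees of freedom are in the state `ψ`. -/
def withMeasured (k : ℕ) (p : ∀ k, V → S.Charge k) (ψ : SetConfig V E (A.sub k) → ℂ) :
    Config V E G → ℂ := fun c =>
  if h : ∀ e, c.2 e ∈ A.sub k then
    measured S k p c.1 * ψ (fun v => QuotientGroup.mk (c.1 v), fun e => ⟨c.2 e, h e⟩) else 0

/-- The state obtained from the SPT state by gauging `G_k`. -/
def setState (k : ℕ) : SetConfig V E (A.sub k) → ℂ :=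
  L.subgroupGaugingMap (A.sub k) (S.cosetRep k) *ᵥ L.spt ω

/-- The state obtained from the SPT state by gauging `G`. -/
def tqdState : (E → G) → ℂ := L.gaugingMap *ᵥ L.spt ω

end Procedure

end TriangulatedSurface

end

noncomputable section

/-! ## Existence of series and embeddings -/

/-! Procedure. Up to a nonzero scalar, the amplitude after `k` neutral rounds at vertex labels `g`
and edge labels `h` is a product of Fourier amplitudes of `g` times a sum of SPT amplitudes over the
configurations `u` that agree with `g` modulo `G_k` and have `h` as the ratios of their parts in
`G_k` (`withMeasured_setState`). The next round, counted from 0, uses the quotient `G_{k+1}/G_k`.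
The controlled shifts turn ratios of parts in `G_k` into ratios of parts in `G_{k+1}`, and the
measurement inserts the phase `∏ conj z^{p_v}(u_v)` into the sum (`measure_entangle_withMeasured`).

Since `z` is a character of `G_{k+1}/G_k`, the quotient `z(u_i)/z(u_j)` is a function of the edge
label alone. A string from `b` to `v` therefore telescopes to `z(u_v)/z(u_b)`, and all strings
together give `∏ z^{p_v}(u_v) / z^{∑ p}(u_b)` (`exists_correct_eq_diagonal`). If the total charge is
zero, this cancels the inserted phase. If it is not, right translation of all `u_v` by one `y ∈
G_{k+1}` preserves cosets, edge labels and SPT amplitudes but multiplies the summand by `conj z^{∑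
p}(y)`. Some `y` makes this different from 1, so the sum is zero (`gaugedSum_eq_zero`).

Ground states. Moving one vertex label, or translating all of them, changes the amplitude of each
triangle by a pentagon identity. Its surplus factors live on edges and cancel between the two
triangles at each edge (`prod_edge_eq_one`). This gives the response `W` of the SPT state to a local
move (`spt_update`), its invariance under right translation (`spt_mul_right`) and the composition
law of the phases (`W_mul`). Hence every term of the Hamiltonians is minus an orthogonal projector
that fixes the gauged state, and the number of terms, negated, is a lower bound for the energy that
is attained. -/

lemma AbelianSeries.nonempty_of_isSolvable (G : Type*) [Group G] [Group.IsSolvable G] :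
    Nonempty (AbelianSeries G) := by
  obtain ⟨n, hn⟩ := Group.IsSolvable.solvable (G := G)
  have hnorm : ∀ k, (derivedSeries G k).Normal := derivedSeries_normal G
  -- The derived series is read backwards; truncated subtraction makes every term from index `n` on
  -- equal to `G`.
  refine ⟨⟨n, fun k => derivedSeries G (n - k),
    fun a b h => derivedSeries_antitone G (by omega), by simpa using hn, by simp,
    fun k => inferInstance, fun k a b => ?_⟩⟩
  induction a using QuotientGroup.induction_on with | _ a => ?_
  induction b using QuotientGroup.induction_on with | _ b => ?_
  rw [← QuotientGroup.mk_mul, ← QuotientGroup.mk_mul, QuotientGroup.eq,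
    Subgroup.mem_subgroupOf]
  by_cases hk : k < n
  · have e : n - k = (n - (k + 1)) + 1 := by omega
    rw [e, derivedSeries_succ]
    have h := Subgroup.commutator_mem_commutator
      (inv_mem b.2 : (b : G)⁻¹ ∈ derivedSeries G (n - (k + 1)))
      (inv_mem a.2 : (a : G)⁻¹ ∈ derivedSeries G (n - (k + 1)))
    simpa [commutatorElement_def, mul_assoc] using h
  · have e : n - k = 0 := by omega
    simp [e]

lemma exists_mulEquiv_multiplicative_pi_zmod (Q : Type*) [Group Q] [Finite Q]
    (hc : ∀ a b : Q, a * b = b * a) :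
    ∃ (r : ℕ) (n : Fin r → ℕ), (∀ j, NeZero (n j)) ∧
      Nonempty (Q ≃* Multiplicative (∀ j, ZMod (n j))) := by
  let _ : CommGroup Q := { mul_comm := hc }
  obtain ⟨ι, _, n, hn, ⟨φ⟩⟩ := CommGroup.equiv_prod_multiplicative_zmod_of_finite Q
  let e := Fintype.equivFin ι
  refine ⟨Fintype.card ι, fun j => n (e.symm j), fun j => ⟨(zero_lt_one.trans (hn (e.symm j))).ne'⟩, ⟨?_⟩⟩
  refine φ.trans (MulEquiv.ofBijective (MonoidHom.mk' (fun x : (i : ι) → Multiplicative (ZMod (n i)) =>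
    Multiplicative.ofAdd fun j => Multiplicative.toAdd (x (e.symm j))) fun a b => rfl) ⟨?_, ?_⟩)
  · intro x y h
    funext i
    have := congrFun (Multiplicative.ofAdd.injective h) (e i)
    change x (e.symm (e i)) = y (e.symm (e i)) at this
    rwa [e.symm_apply_apply] at this
  · intro y
    obtain ⟨x, hx⟩ := (Equiv.piCongrLeft' (fun i => ZMod (n i)) e).surjective
      (Multiplicative.toAdd y)
    exact ⟨fun i => Multiplicative.ofAdd (x i), congrArg Multiplicative.ofAdd hx⟩

lemma AbelianSeries.nonempty_embedding {G : Type*} [Group G] [Finite G] (A : AbelianSeries G) :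
    Nonempty A.Embedding := by
  choose r n hn φ using fun k => exists_mulEquiv_multiplicative_pi_zmod (A.Q k) (A.comm k)
  refine ⟨⟨r, n, hn, fun k => (φ k).some, fun k q => if q = 1 then 1 else q.out, fun k q => ?_,
    fun k => by simp⟩⟩
  split_ifs with h
  · rw [h]; rfl
  · exact QuotientGroup.out_eq' q

namespace AbelianSeries.Embedding

variable {G : Type*} [Group G] {A : AbelianSeries G} (S : A.Embedding)

/-! ## The factors of a product and of an element of the series -/

/-- Rests on the normalisation of the sections at the identity. It makes the higher factors of an
element of `G_k` trivial, so that stripping them changes nothing. -/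
lemma rep_of_mem {k : ℕ} {x : G} (hx : x ∈ A.sub k) : S.rep k x = 1 := by
  unfold rep
  split_ifs with h
  · have e : (QuotientGroup.mk ⟨x, h⟩ : A.Q k) = 1 := by
      rw [QuotientGroup.eq_one_iff, Subgroup.mem_subgroupOf]; exact hx
    rw [e, S.sec_one]; rfl
  · rfl

lemma strip_of_mem {m : ℕ} (hm : m ≤ A.length) {x : G} (hx : x ∈ A.sub (A.length - m)) :
    S.strip m x = x := by
  induction m with
  | zero => rfl
  | succ m ih =>
    have h := ih (by omega) (A.mono (by omega) hx)
    rw [strip, h, S.rep_of_mem hx, inv_one, one_mul]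

lemma low_of_mem {k : ℕ} {x : G} (hx : x ∈ A.sub k) : S.low k x = x := by
  by_cases hk : k ≤ A.length
  · exact S.strip_of_mem (by omega) (by rwa [Nat.sub_sub_self hk])
  · rw [low, Nat.sub_eq_zero_of_le (by omega)]; rfl

lemma low_length (x : G) : S.low A.length x = x :=
  S.low_of_mem (by rw [A.sub_length]; trivial)

lemma low_mul {k : ℕ} (hk : k ≤ A.length) (g : G) {x : G} (hx : x ∈ A.sub k) :
    S.low k (g * x) = S.low k g * x :=
  S.strip_mul k _ (by omega) g x hx

lemma cls_of_mem {k : ℕ} {x : G} (hx : x ∈ A.sub (k + 1)) :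
    S.cls k x = QuotientGroup.mk ⟨x, hx⟩ := by
  unfold cls
  congr 2
  exact S.low_of_mem hx

lemma cls_low (k : ℕ) (g : G) : S.cls k (S.low (k + 1) g) = S.cls k g :=
  S.cls_of_mem (S.low_mem (k + 1) g)

lemma cls_mul_of_mem {k : ℕ} {x y : G} (hx : x ∈ A.sub (k + 1)) (hy : y ∈ A.sub (k + 1)) :
    S.cls k (x * y) = S.cls k x * S.cls k y := by
  rw [S.cls_of_mem hx, S.cls_of_mem hy, S.cls_of_mem (mul_mem hx hy)]; rfl

lemma cls_mul {k : ℕ} (hk : k < A.length) (g : G) {y : G} (hy : y ∈ A.sub (k + 1)) :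
    S.cls k (g * y) = S.cls k g * S.cls k y := by
  rw [← S.cls_low k (g * y), S.low_mul hk g hy, S.cls_mul_of_mem (S.low_mem _ g) hy, S.cls_low]

/-- Inside `G_{k+1}` the class map is a homomorphism, although the factorisation `q_N ⋯ q_1` of `G`
is not multiplicative. Commutativity of the quotient serves only to order the two factors. -/
lemma cls_eq_cls_mul (k : ℕ) (g h : G) :
    S.cls k g = S.cls k h * S.cls k (S.low (k + 1) g * (S.low (k + 1) h)⁻¹) := by
  have hg := S.low_mem (k + 1) g
  have hh := S.low_mem (k + 1) h
  rw [← S.cls_low k h, A.comm, ← S.cls_mul_of_mem (mul_mem hg (inv_mem hh)) hh,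
    inv_mul_cancel_right, S.cls_low]

lemma cls_mul_of_le {j k : ℕ} (hkj : k ≤ j) (hj : j < A.length) (g : G) {x : G}
    (hx : x ∈ A.sub k) : S.cls j (g * x) = S.cls j g := by
  rw [S.cls_mul hj g (A.mono (by omega) hx)]
  have : S.cls j x = 1 := by
    rw [S.cls_of_mem (A.mono (by omega) hx), QuotientGroup.eq_one_iff, Subgroup.mem_subgroupOf]
    exact A.mono hkj hx
  rw [this, mul_one]

lemma cls_eq_of_mk_eq {j k : ℕ} (hkj : k ≤ j) (hj : j < A.length) {g h : G}
    (e : (QuotientGroup.mk g : G ⧸ A.sub k) = QuotientGroup.mk h) : S.cls j g = S.cls j h := by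
  rw [QuotientGroup.eq] at e
  rw [← S.cls_mul_of_le hkj hj g e, mul_inv_cancel_left]

lemma low_eq_of_low_eq {k : ℕ} (hk : k ≤ A.length) {g h : G} (e : S.low k g = S.low k h) {j : ℕ}
    (hj : j ≤ k) : S.low j g = S.low j h := by
  induction k with
  | zero => rwa [Nat.le_zero.1 hj]
  | succ k ih =>
    rcases Nat.lt_or_ge k j with h1 | h1
    · rwa [show j = k + 1 by omega]
    · refine ih (by omega) ?_ h1
      have h2 : S.digit k g = S.digit k h := by
        unfold digit; rw [← S.cls_low k g, e, S.cls_low]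
      have h3 := S.low_succ (by omega : k < A.length) g
      rw [e, S.low_succ (by omega) h, h2] at h3
      exact (mul_left_cancel h3).symm

lemma cls_eq_of_low_eq {k : ℕ} (hk : k ≤ A.length) {g h : G} (e : S.low k g = S.low k h) {j : ℕ}
    (hj : j < k) : S.cls j g = S.cls j h := by
  rw [← S.cls_low j g, S.low_eq_of_low_eq hk e (Nat.succ_le_of_lt hj), S.cls_low]

lemma eq_of_cls_eq {g h : G} (e : ∀ j < A.length, S.cls j g = S.cls j h) : g = h := by
  rw [← S.prod_digit g, ← S.prod_digit h]
  congr 1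
  refine List.map_congr_left fun j hj => ?_
  rw [digit, digit, e j (by simpa using hj)]

/-- Replacing the part of `g` in `G_k` by that of `h` is a right multiplication by an element of
`G_k`. The result has all factors in common with `h`, hence equals `h`. -/
lemma mk_eq_of_cls_eq {k : ℕ} (hk : k ≤ A.length) {g h : G}
    (e : ∀ j < A.length, k ≤ j → S.cls j g = S.cls j h) :
    (QuotientGroup.mk g : G ⧸ A.sub k) = QuotientGroup.mk h := by
  have hm : (S.low k g)⁻¹ * S.low k h ∈ A.sub k :=
    mul_mem (inv_mem (S.low_mem k g)) (S.low_mem k h)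
  have : g * ((S.low k g)⁻¹ * S.low k h) = h := by
    refine S.eq_of_cls_eq fun j hj => ?_
    rcases Nat.lt_or_ge j k with h1 | h1
    · refine S.cls_eq_of_low_eq hk ?_ h1
      rw [S.low_mul hk _ hm, mul_inv_cancel_left]
    · rw [S.cls_mul_of_le h1 hj _ hm, e j hj h1]
  rw [QuotientGroup.eq, ← this, inv_mul_cancel_left]
  exact hm

/-- Among the elements that differ from `x` only in the `k`-th factor, exactly one lies in the
`G_k`-coset of `z`, provided that `x` and `z` have the same higher factors. -/
lemma cls_eq_and_mk_eq_iff {k : ℕ} (hk : k < A.length) (x y z : G) :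
    ((∀ j < A.length, j ≠ k → S.cls j x = S.cls j y) ∧
        (QuotientGroup.mk y : G ⧸ A.sub k) = QuotientGroup.mk z) ↔
      (QuotientGroup.mk x : G ⧸ A.sub (k + 1)) = QuotientGroup.mk z ∧
        y = z * ((S.low k z)⁻¹ * S.low k x) := by
  have hm : (S.low k z)⁻¹ * S.low k x ∈ A.sub k :=
    mul_mem (inv_mem (S.low_mem k z)) (S.low_mem k x)
  have hlow : S.low k (z * ((S.low k z)⁻¹ * S.low k x)) = S.low k x := by
    rw [S.low_mul hk.le _ hm, mul_inv_cancel_left]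
  constructor
  · rintro ⟨h1, h2⟩
    refine ⟨S.mk_eq_of_cls_eq hk fun j hj hkj => ?_, S.eq_of_cls_eq fun j hj => ?_⟩
    · rw [h1 j hj (by omega), S.cls_eq_of_mk_eq (by omega) hj h2]
    · rcases Nat.lt_or_ge j k with h3 | h3
      · rw [← h1 j hj h3.ne, S.cls_eq_of_low_eq hk.le hlow h3]
      · rw [S.cls_mul_of_le h3 hj _ hm, S.cls_eq_of_mk_eq h3 hj h2]
  · rintro ⟨h1, rfl⟩
    refine ⟨fun j hj hjk => ?_, ?_⟩
    · rcases Nat.lt_or_ge j k with h3 | h3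
      · exact (S.cls_eq_of_low_eq hk.le hlow h3).symm
      · rw [S.cls_mul_of_le h3 hj _ hm, S.cls_eq_of_mk_eq (by omega) hj h1]
    · rw [eq_comm, QuotientGroup.eq, inv_mul_cancel_left]; exact hm

lemma digit_eq_of_mk_eq {k : ℕ} (hk : k < A.length) {g h : G}
    (e : (QuotientGroup.mk g : G ⧸ A.sub k) = QuotientGroup.mk h) : S.digit k g = S.digit k h := by
  rw [digit, digit, S.cls_eq_of_mk_eq le_rfl hk e]

/-! ## Phases -/

lemma zPhase_congr (k : ℕ) (i : S.Charge k) {g h : G} (e : S.cls k g = S.cls k h) :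
    S.zPhase k i g = S.zPhase k i h := by
  rw [zPhase, zPhase, e]

lemma zPhase_zero (k : ℕ) (g : G) : S.zPhase k 0 g = 1 := by simp [zPhase]

lemma zPhase_add (k : ℕ) (i j : S.Charge k) (g : G) :
    S.zPhase k (i + j) g = S.zPhase k i g * S.zPhase k j g := by
  simp [zPhase, add_mul, AddChar.map_add_eq_mul, Finset.prod_mul_distrib]

lemma zPhase_neg (k : ℕ) (i : S.Charge k) (g : G) :
    S.zPhase k (-i) g = (S.zPhase k i g)⁻¹ := by
  refine eq_inv_of_mul_eq_one_left ?_
  rw [← zPhase_add, neg_add_cancel, zPhase_zero]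

lemma zPhase_ne_zero (k : ℕ) (i : S.Charge k) (g : G) : S.zPhase k i g ≠ 0 :=
  left_ne_zero_of_mul_eq_one (b := S.zPhase k (-i) g) (by
    rw [← zPhase_add, add_neg_cancel, zPhase_zero])

lemma zPhase_sum (k : ℕ) {ι : Type*} (s : Finset ι) (p : ι → S.Charge k) (g : G) :
    S.zPhase k (∑ v ∈ s, p v) g = ∏ v ∈ s, S.zPhase k (p v) g := by
  induction s using Finset.induction_on with
  | empty => simp [zPhase_zero]
  | insert v s hv ih => rw [Finset.sum_insert hv, Finset.prod_insert hv, zPhase_add, ih]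

lemma zPhase_of_cls_mul (k : ℕ) (i : S.Charge k) {x y z : G}
    (e : S.cls k x = S.cls k y * S.cls k z) :
    S.zPhase k i x = S.zPhase k i y * S.zPhase k i z := by
  simp only [zPhase, e, map_mul, toAdd_mul, Pi.add_apply, mul_add, AddChar.map_add_eq_mul,
    Finset.prod_mul_distrib]

/-- The transmutation rule. -/
lemma zPhase_transmutation (k : ℕ) (i : S.Charge k) (g h : G) :
    S.zPhase k i g = S.zPhase k i h * S.zPhase k i (S.low (k + 1) g * (S.low (k + 1) h)⁻¹) :=
  S.zPhase_of_cls_mul k i (S.cls_eq_cls_mul k g h)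

lemma zPhase_mul {k : ℕ} (hk : k < A.length) (i : S.Charge k) (g : G) {y : G}
    (hy : y ∈ A.sub (k + 1)) : S.zPhase k i (g * y) = S.zPhase k i g * S.zPhase k i y :=
  S.zPhase_of_cls_mul k i (S.cls_mul hk g hy)

lemma star_zPhase (k : ℕ) (i : S.Charge k) (g : G) :
    star (S.zPhase k i g) = (S.zPhase k i g)⁻¹ := by
  simp only [zPhase, star_prod, ← Finset.prod_inv_distrib]
  refine Finset.prod_congr rfl fun j _ => ?_
  rw [ZMod.stdAddChar_apply, ← Circle.coe_inv, Circle.coe_inv_eq_conj]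
  rfl

lemma exists_zPhase_ne_one (k : ℕ) {i : S.Charge k} (hi : i ≠ 0) :
    ∃ y ∈ A.sub (k + 1), S.zPhase k i y ≠ 1 := by
  obtain ⟨j, hj⟩ := Function.ne_iff.1 hi
  -- At the class with a single coordinate 1, in a position where `i` is nonzero, the phase is the
  -- standard character at `i j`, which is injective.
  let q : A.Q k := (S.coord k).symm (Multiplicative.ofAdd (Pi.single j 1))
  refine ⟨S.sec k q, (S.sec k q).2, fun h => hj ?_⟩
  have e : S.cls k (S.sec k q) = q := by
    rw [S.cls_of_mem (S.sec k q).2]; exact S.sec_spec k q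
  rw [zPhase, e, Finset.prod_eq_single j] at h
  · simp only [q, MulEquiv.apply_symm_apply, toAdd_ofAdd, Pi.single_eq_same, mul_one] at h
    exact ZMod.injective_stdAddChar (by rw [h, Pi.zero_apply, AddChar.map_zero_eq_one])
  · intro l _ hl
    simp [q, Pi.single_eq_of_ne hl]
  · simp

lemma fourier_congr (k : ℕ) (i : S.Charge k) {g h : G} (e : S.cls k g = S.cls k h) :
    S.fourier k i g = S.fourier k i h := by
  rw [fourier, fourier, S.zPhase_congr k i e]

lemma fourier_ne_zero [Finite G] (k : ℕ) (i : S.Charge k) (g : G) : S.fourier k i g ≠ 0 := by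
  refine div_ne_zero (S.zPhase_ne_zero k i g) ?_
  rw [Complex.ofReal_ne_zero, Real.sqrt_ne_zero (by positivity), Nat.cast_ne_zero]
  exact Nat.card_pos.ne'

end AbelianSeries.Embedding

namespace TriangulatedSurface

/-! ## Cocycle identities on the surface -/

section Cocycle

variable {V E F : Type*} (L : TriangulatedSurface V E F)

lemma v1_ne_v2 (f : F) : L.v1 f ≠ L.v2 f := L.loopless _

lemma v2_ne_v3 (f : F) : L.v2 f ≠ L.v3 f := by
  rw [v2, ← L.mid_eq]; exact L.loopless _

lemma v1_ne_v3 (f : F) : L.v1 f ≠ L.v3 f := by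
  rw [v1, v3, ← L.src_eq, ← L.tgt_eq]; exact L.loopless _

lemma src_bd_zero (f : F) : L.src (L.bd f 0) = L.v1 f := rfl
lemma tgt_bd_zero (f : F) : L.tgt (L.bd f 0) = L.v2 f := rfl
lemma src_bd_one (f : F) : L.src (L.bd f 1) = L.v2 f := L.mid_eq f
lemma tgt_bd_one (f : F) : L.tgt (L.bd f 1) = L.v3 f := rfl
lemma src_bd_two (f : F) : L.src (L.bd f 2) = L.v1 f := L.src_eq f
lemma tgt_bd_two (f : F) : L.tgt (L.bd f 2) = L.v3 f := L.tgt_eq f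

/-- Edge factors cancel between the two triangles at every edge. -/
lemma prod_edge_eq_one [Fintype E] [Fintype F] {M : Type*} [CommGroup M] (c : E → M) :
    ∏ f, (c (L.bd f 0) * c (L.bd f 1) * (c (L.bd f 2))⁻¹) ^ (L.sgn f : ℤ) = 1 := by
  have h1 : ∏ f, (c (L.bd f 0) * c (L.bd f 1) * (c (L.bd f 2))⁻¹) ^ (L.sgn f : ℤ) =
      ∏ x : F × Fin 3,
        c (L.bd x.1 x.2) ^ ((L.sgn x.1 * (![1, 1, -1] : Fin 3 → ℤˣ) x.2 : ℤˣ) : ℤ) := by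
    rw [Fintype.prod_prod_type]
    refine Finset.prod_congr rfl fun f _ => ?_
    simp [Fin.prod_univ_three, mul_zpow]
  rw [h1, ← Finset.prod_fiberwise Finset.univ fun x : F × Fin 3 => L.bd x.1 x.2]
  refine Finset.prod_eq_one fun e _ => ?_
  obtain ⟨a, b, hab, h, hs⟩ := L.closed e
  have hf : (Finset.univ.filter fun x : F × Fin 3 => L.bd x.1 x.2 = e) = {a, b} := by
    ext x; simp [h]
  rw [hf, Finset.prod_pair hab, (h a).2 (Or.inl rfl), (h b).2 (Or.inr rfl), hs]
  simp

variable {G : Type*} [Group G] (ω : G → G → G → Circle)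

/-- The labels `g_i g_j⁻¹` on the edges `j → i`. -/
def edgeRatio {M : Type*} [Group M] (g : V → M) : E → M := fun e =>
  g (L.tgt e) * (g (L.src e))⁻¹

lemma flat_edgeRatio {M : Type*} [Group M] (g : V → M) (f : F) : L.Flat (L.edgeRatio g) f := by
  simp [Flat, edgeRatio, src_bd_zero, tgt_bd_zero, src_bd_one, tgt_bd_one, src_bd_two, tgt_bd_two]

lemma edgeRatio_update {M : Type*} [Group M] (g : V → M) (v : V) (x : M) :
    L.edgeRatio (Function.update g v (x * g v)) = L.shift v x (L.edgeRatio g) := by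
  funext e
  have := L.loopless e
  unfold edgeRatio shift
  by_cases h1 : L.tgt e = v
  · subst h1; simp [Function.update_of_ne this, mul_assoc]
  · by_cases h2 : L.src e = v
    · subst h2; simp [this.symm, mul_assoc]
    · simp [h1, h2]

/-- The amplitude of the SPT state at a triangle. -/
def sptFace (g : V → G) (f : F) : Circle :=
  ω (g (L.v3 f) * (g (L.v2 f))⁻¹) (g (L.v2 f) * (g (L.v1 f))⁻¹) (g (L.v1 f)) ^ (L.sgn f : ℤ)

variable {ω}

/-- A triangle amplitude is the cocycle of the tetrahedron over the triangle with an extra base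
point joined to vertex `v` by an edge labelled `g_v`. Lifting `v` to `v'` is then a pentagon
identity on five vertices. -/
lemma sptFace_update (hω : IsThreeCocycle ω) (g : V → G) (v : V) (x : G) :
    ∃ c : E → Circle, ∀ f, L.sptFace ω (Function.update g v (x * g v)) f =
      L.tetra ω v x (L.edgeRatio g) f * L.sptFace ω g f *
        (c (L.bd f 0) * c (L.bd f 1) * (c (L.bd f 2))⁻¹) ^ (L.sgn f : ℤ) := by
  -- The factor of an edge at `v` comes from the tetrahedron spanned by the base point, that edge
  -- and the lift `v'`. The two cases differ in the order of its vertices.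
  refine ⟨fun e => if L.tgt e = v then (ω x (g (L.tgt e) * (g (L.src e))⁻¹) (g (L.src e)))⁻¹
    else if L.src e = v then ω (g (L.tgt e) * (g (L.src e))⁻¹ * x⁻¹) x (g (L.src e)) else 1,
    fun f => ?_⟩
  have h12 := L.v1_ne_v2 f
  have h23 := L.v2_ne_v3 f
  have h13 := L.v1_ne_v3 f
  simp only [tetra, sptFace, edgeRatio, src_bd_zero, tgt_bd_zero, src_bd_one, tgt_bd_one,
    src_bd_two, tgt_bd_two]
  by_cases hv3 : v = L.v3 f
  · subst hv3
    simp only [if_true, h23, h13, if_false, Function.update_self, ne_eq, not_false_eq_true,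
      Function.update_of_ne, ← mul_zpow]
    congr 1
    have := hω x (g (L.v3 f) * (g (L.v2 f))⁻¹) (g (L.v2 f) * (g (L.v1 f))⁻¹) (g (L.v1 f))
    simp only [mul_assoc, inv_mul_cancel_left, inv_mul_cancel, mul_one] at this ⊢
    apply Circle.ext
    have := congrArg (fun z : Circle => (z : ℂ)) this
    simp only [Circle.coe_mul, Circle.coe_inv, Circle.coe_one] at this ⊢
    field_simp
    linear_combination -this
  by_cases hv2 : v = L.v2 f
  · subst hv2
    simp only [if_true, h12, h23, h23.symm, if_false, Function.update_self, ne_eq,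
      not_false_eq_true, Function.update_of_ne, _root_.zpow_neg, ← _root_.inv_zpow, ← mul_zpow]
    congr 1
    have := hω (g (L.v3 f) * (g (L.v2 f))⁻¹ * x⁻¹) x (g (L.v2 f) * (g (L.v1 f))⁻¹) (g (L.v1 f))
    simp only [mul_assoc, inv_mul_cancel, mul_one, _root_.mul_inv_rev] at this ⊢
    apply Circle.ext
    have := congrArg (fun z : Circle => (z : ℂ)) this
    simp only [Circle.coe_mul, Circle.coe_inv, Circle.coe_one] at this ⊢
    field_simp
    linear_combination this
  by_cases hv1 : v = L.v1 f
  · subst hv1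
    simp only [if_true, h12, h12.symm, h13, h13.symm, if_false, Function.update_self, ne_eq,
      not_false_eq_true, Function.update_of_ne, ← mul_zpow]
    congr 1
    have := hω (g (L.v3 f) * (g (L.v2 f))⁻¹) (g (L.v2 f) * (g (L.v1 f))⁻¹ * x⁻¹) x (g (L.v1 f))
    simp only [mul_assoc, inv_mul_cancel_left, inv_mul_cancel, mul_one, _root_.mul_inv_rev] at this ⊢
    apply Circle.ext
    have := congrArg (fun z : Circle => (z : ℂ)) this
    simp only [Circle.coe_mul, Circle.coe_inv] at this ⊢
    field_simp
    linear_combination -this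
  · simp [hv1, hv2, hv3, Ne.symm hv1, Ne.symm hv2, Ne.symm hv3]

/-- The pentagon with a second base point, joined to the first by an edge labelled `y`. -/
lemma sptFace_mul_right (hω : IsThreeCocycle ω) (g : V → G) (y : G) :
    ∃ c : E → Circle, ∀ f, L.sptFace ω (fun v => g v * y) f = L.sptFace ω g f *
        (c (L.bd f 0) * c (L.bd f 1) * (c (L.bd f 2))⁻¹) ^ (L.sgn f : ℤ) := by
  refine ⟨fun e => ω (g (L.tgt e) * (g (L.src e))⁻¹) (g (L.src e)) y, fun f => ?_⟩
  simp only [sptFace, src_bd_zero, tgt_bd_zero, src_bd_one, tgt_bd_one,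
    src_bd_two, tgt_bd_two, ← mul_zpow]
  congr 1
  have := hω (g (L.v3 f) * (g (L.v2 f))⁻¹) (g (L.v2 f) * (g (L.v1 f))⁻¹) (g (L.v1 f)) y
  simp only [mul_assoc, inv_mul_cancel_left, inv_mul_cancel, mul_one, _root_.mul_inv_rev,
    mul_inv_cancel_left] at this ⊢
  apply Circle.ext
  have := congrArg (fun z : Circle => (z : ℂ)) this
  simp only [Circle.coe_mul, Circle.coe_inv] at this ⊢
  field_simp
  linear_combination -this

lemma flat_shift_iff {M : Type*} [Group M] (v : V) (x : M) (h : E → M) (f : F) :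
    L.Flat (L.shift v x h) f ↔ L.Flat h f := by
  have h12 := L.v1_ne_v2 f
  have h23 := L.v2_ne_v3 f
  have h13 := L.v1_ne_v3 f
  simp only [Flat, shift, src_bd_zero, tgt_bd_zero, src_bd_one, tgt_bd_one, src_bd_two, tgt_bd_two]
  by_cases hv3 : v = L.v3 f
  · subst hv3; simp [h23, h13, mul_assoc]
  by_cases hv2 : v = L.v2 f
  · subst hv2; simp [h12, h23.symm, mul_assoc]
  by_cases hv1 : v = L.v1 f
  · subst hv1; simp [h12.symm, h13.symm, ← mul_assoc]
  · simp [Ne.symm hv1, Ne.symm hv2, Ne.symm hv3]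

lemma shift_mul {M : Type*} [Group M] (v : V) (x y : M) (h : E → M) :
    L.shift v (x * y) h = L.shift v x (L.shift v y h) := by
  funext e
  unfold shift
  split_ifs <;> simp [mul_assoc]

lemma shift_one {M : Type*} [Group M] (v : V) (h : E → M) : L.shift v 1 h = h := by
  funext e
  simp [shift]

/-- The pentagon for two successive lifts `v → v' → v''`. The surplus factors are the tetrahedra
spanned by an edge at `v` and both lifts. Flatness identifies the label of the long edge with the
product of the other two. -/
lemma tetra_mul (hω : IsThreeCocycle ω) (v : V) (x y : G) (h : E → G) :
    ∃ c : E → Circle, ∀ f, (v = L.v1 f ∨ v = L.v2 f ∨ v = L.v3 f → L.Flat h f) →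
      L.tetra ω v (x * y) h f = L.tetra ω v x (L.shift v y h) f * L.tetra ω v y h f *
        (c (L.bd f 0) * c (L.bd f 1) * (c (L.bd f 2))⁻¹) ^ (L.sgn f : ℤ) := by
  refine ⟨fun e => if L.tgt e = v then ω x y (h e)
    else if L.src e = v then ω (h e * y⁻¹ * x⁻¹) x y else 1, fun f hf => ?_⟩
  have h12 := L.v1_ne_v2 f
  have h23 := L.v2_ne_v3 f
  have h13 := L.v1_ne_v3 f
  simp only [tetra, shift, src_bd_zero, tgt_bd_zero, src_bd_one, tgt_bd_one,
    src_bd_two, tgt_bd_two]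
  by_cases hv3 : v = L.v3 f
  · have hfl : h (L.bd f 1) * h (L.bd f 0) = h (L.bd f 2) := hf (Or.inr (Or.inr hv3))
    subst hv3
    simp only [if_true, h23, h13, if_false, ← mul_zpow]
    congr 1
    have := hω x y (h (L.bd f 1)) (h (L.bd f 0))
    rw [hfl] at this
    apply Circle.ext
    have := congrArg (fun z : Circle => (z : ℂ)) this
    simp only [Circle.coe_mul, Circle.coe_inv, Circle.coe_one] at this ⊢
    field_simp
    linear_combination -this
  by_cases hv2 : v = L.v2 f
  · subst hv2
    simp only [if_true, h12, h23, h23.symm, if_false, _root_.zpow_neg, ← _root_.inv_zpow, ← mul_zpow]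
    congr 1
    have := hω (h (L.bd f 1) * y⁻¹ * x⁻¹) x y (h (L.bd f 0))
    simp only [mul_assoc, inv_mul_cancel, mul_one, _root_.mul_inv_rev] at this ⊢
    apply Circle.ext
    have := congrArg (fun z : Circle => (z : ℂ)) this
    simp only [Circle.coe_mul, Circle.coe_inv, Circle.coe_one] at this ⊢
    field_simp
    linear_combination -this
  by_cases hv1 : v = L.v1 f
  · have hfl : h (L.bd f 1) * h (L.bd f 0) = h (L.bd f 2) := hf (Or.inl hv1)
    subst hv1
    simp only [if_true, h12, h12.symm, h13, h13.symm, if_false, ← mul_zpow]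
    congr 1
    have := hω (h (L.bd f 1)) (h (L.bd f 0) * y⁻¹ * x⁻¹) x y
    rw [← hfl]
    simp only [mul_assoc, inv_mul_cancel, mul_one, _root_.mul_inv_rev] at this ⊢
    apply Circle.ext
    have := congrArg (fun z : Circle => (z : ℂ)) this
    simp only [Circle.coe_mul, Circle.coe_inv] at this ⊢
    field_simp
    linear_combination -this
  · simp [hv1, hv2, hv3, Ne.symm hv1, Ne.symm hv2, Ne.symm hv3]

variable [Fintype F]

lemma norm_W (v : V) (x : G) (h : E → G) : ‖L.W ω v x h‖ = 1 := by
  unfold W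
  split_ifs
  · exact Circle.norm_coe _
  · simp

lemma spt_eq_prod (g : V → G) : L.spt ω g = ((∏ f, L.sptFace ω g f : Circle) : ℂ) := by
  change _ = Circle.coeHom _
  rw [map_prod]
  rfl

lemma spt_ne_zero (g : V → G) : L.spt ω g ≠ 0 := by
  rw [spt_eq_prod]; exact Circle.coe_ne_zero _

variable [Fintype E]

lemma spt_update (hω : IsThreeCocycle ω) (g : V → G) (v : V) (x : G) :
    L.spt ω (Function.update g v (x * g v)) = L.W ω v x (L.edgeRatio g) * L.spt ω g := by
  obtain ⟨c, hc⟩ := L.sptFace_update hω g v x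
  rw [W, if_pos fun f _ => L.flat_edgeRatio g f, spt_eq_prod, spt_eq_prod, ← Circle.coe_mul,
    Finset.prod_congr rfl fun f _ => hc f, Finset.prod_mul_distrib, Finset.prod_mul_distrib,
    L.prod_edge_eq_one c, mul_one]

lemma spt_mul_right (hω : IsThreeCocycle ω) (g : V → G) (y : G) :
    L.spt ω (fun v => g v * y) = L.spt ω g := by
  obtain ⟨c, hc⟩ := L.sptFace_mul_right hω g y
  rw [spt_eq_prod, spt_eq_prod, Finset.prod_congr rfl fun f _ => hc f, Finset.prod_mul_distrib,
    L.prod_edge_eq_one c, mul_one]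

/-- The default value 1 is compatible with composition, because a shift at `v` does not change which
triangles are flat. -/
lemma W_mul (hω : IsThreeCocycle ω) (v : V) (x y : G) (h : E → G) :
    L.W ω v (x * y) h = L.W ω v x (L.shift v y h) * L.W ω v y h := by
  unfold W
  simp only [flat_shift_iff]
  split_ifs with hf
  · obtain ⟨c, hc⟩ := L.tetra_mul hω v x y h
    rw [Finset.prod_congr rfl fun f _ => hc f (hf f), Finset.prod_mul_distrib,
      Finset.prod_mul_distrib, L.prod_edge_eq_one c, mul_one, Circle.coe_mul]
  · rw [mul_one]

end Cocycle

end TriangulatedSurface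

/-! ## Frustration-free ground states -/

section GroundState

variable {C : Type*} [Fintype C]

/-- `E₀` is a lower bound for the Hamiltonian `H` that is attained at `ψ`. -/
structure AttainsBound (H : Matrix C C ℂ) (ψ : C → ℂ) (E₀ : ℝ) : Prop where
  isHermitian : H.IsHermitian
  mulVec_eq : H *ᵥ ψ = (E₀ : ℂ) • ψ
  le : ∀ φ : C → ℂ, E₀ * (star φ ⬝ᵥ φ).re ≤ (star φ ⬝ᵥ (H *ᵥ φ)).re

lemma AttainsBound.isGroundState {H : Matrix C C ℂ} {ψ : C → ℂ} {E₀ : ℝ}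
    (h : AttainsBound H ψ E₀) (hψ : ψ ≠ 0) : IsGroundState H ψ :=
  ⟨h.isHermitian, hψ, E₀, h.mulVec_eq, h.le⟩

lemma AttainsBound.zero (ψ : C → ℂ) : AttainsBound (0 : Matrix C C ℂ) ψ 0 :=
  ⟨Matrix.isHermitian_zero, by simp, fun φ => by simp⟩

lemma AttainsBound.add {H H' : Matrix C C ℂ} {ψ : C → ℂ} {a b : ℝ} (h : AttainsBound H ψ a)
    (h' : AttainsBound H' ψ b) : AttainsBound (H + H') ψ (a + b) := by
  refine ⟨h.isHermitian.add h'.isHermitian, ?_, fun φ => ?_⟩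
  · rw [add_mulVec, h.mulVec_eq, h'.mulVec_eq, ← add_smul, Complex.ofReal_add]
  · rw [add_mulVec, dotProduct_add, Complex.add_re, add_mul]
    exact add_le_add (h.le φ) (h'.le φ)

lemma AttainsBound.sum {ι : Type*} (s : Finset ι) {H : ι → Matrix C C ℂ} {ψ : C → ℂ} {a : ι → ℝ}
    (h : ∀ i, AttainsBound (H i) ψ (a i)) : AttainsBound (∑ i ∈ s, H i) ψ (∑ i ∈ s, a i) := by
  induction s using Finset.induction_on with
  | empty => simpa using AttainsBound.zero ψ
  | insert i s hi ih => rw [Finset.sum_insert hi, Finset.sum_insert hi]; exact (h i).add ih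

/-- An orthogonal projector `P` that fixes `ψ`. -/
structure Stabilizes (P : Matrix C C ℂ) (ψ : C → ℂ) : Prop where
  isHermitian : P.IsHermitian
  mul_self : P * P = P
  mulVec_eq : P *ᵥ ψ = ψ

open ComplexOrder in
lemma Stabilizes.attainsBound_neg {P : Matrix C C ℂ} {ψ : C → ℂ} (h : Stabilizes P ψ) :
    AttainsBound (-P) ψ (-1) := by
  refine ⟨h.isHermitian.neg, by rw [neg_mulVec, h.mulVec_eq]; simp, fun φ => ?_⟩
  -- The complement of an orthogonal projector is again one, hence positive semidefinite, so `-P` is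
  -- bounded below by `-1`.
  have e : (1 - P)ᴴ * (1 - P) = 1 - P := by
    rw [conjTranspose_sub, conjTranspose_one, h.isHermitian.eq, sub_mul, mul_sub, mul_sub,
      h.mul_self]
    simp
  have hp : (1 - P).PosSemidef := e ▸ posSemidef_conjTranspose_mul_self (1 - P)
  have := hp.re_dotProduct_nonneg φ
  rw [sub_mulVec, one_mulVec, dotProduct_sub] at this
  simp only [map_sub, RCLike.re_to_complex] at this
  rw [neg_mulVec, dotProduct_neg, Complex.neg_re]
  linarith

lemma stabilizes_diagonal_indicator [DecidableEq C] (p : C → Prop) [DecidablePred p]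
    {ψ : C → ℂ} (h : ∀ c, ψ c ≠ 0 → p c) :
    Stabilizes (Matrix.diagonal fun c => if p c then (1 : ℂ) else 0) ψ := by
  refine ⟨?_, ?_, ?_⟩
  · rw [isHermitian_diagonal_iff]
    intro c
    split_ifs <;> simp [IsSelfAdjoint]
  · rw [diagonal_mul_diagonal]
    congr 1
    funext c
    split_ifs <;> simp
  · funext c
    rw [mulVec_diagonal]
    by_cases hc : p c
    · simp [hc]
    · simp [hc, not_not.1 (mt (h c) hc)]

lemma mul_star_self_of_norm {z : ℂ} (h : ‖z‖ = 1) : star z * z = 1 := by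
  rw [← starRingEnd_apply, Complex.conj_mul', h]; simp

/-- The average over a group acting on the basis labels with phases. -/
lemma stabilizes_orbitAverage [DecidableEq C] {M : Type*} [Group M] [Fintype M] {T : M → C → C}
    {w : M → C → ℂ} {P : Matrix C C ℂ} {ψ : C → ℂ}
    (hP : ∀ c' c, P c' c = (Fintype.card M : ℂ)⁻¹ * ∑ x, if c' = T x c then w x c else 0)
    (T_one : ∀ c, T 1 c = c) (T_mul : ∀ x y c, T (x * y) c = T x (T y c))
    (w_norm : ∀ x c, ‖w x c‖ = 1) (w_mul : ∀ x y c, w (x * y) c = w x (T y c) * w y c)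
    (hψ : ∀ x c, w x c * ψ c = ψ (T x c)) : Stabilizes P ψ := by
  have hM : (Fintype.card M : ℂ) ≠ 0 := Nat.cast_ne_zero.2 Fintype.card_ne_zero
  have T_inv : ∀ x c, T x⁻¹ (T x c) = c := fun x c => by rw [← T_mul, inv_mul_cancel, T_one]
  have T_inv' : ∀ x c, T x (T x⁻¹ c) = c := fun x c => by rw [← T_mul, mul_inv_cancel, T_one]
  have T_iff : ∀ x c' c, c' = T x c ↔ c = T x⁻¹ c' := fun x c' c =>
    ⟨fun h => by rw [h, T_inv], fun h => by rw [h, T_inv']⟩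
  have w_one : ∀ c, w 1 c = 1 := fun c => by
    have h := w_mul 1 1 c
    rw [mul_one, T_one] at h
    exact mul_right_cancel₀ (norm_ne_zero_iff.1 (by rw [w_norm 1 c]; exact one_ne_zero))
      (by rw [one_mul, ← h])
  refine ⟨?_, ?_, ?_⟩
  · ext c' c
    rw [conjTranspose_apply, hP, hP]
    simp only [star_mul', star_inv₀, star_natCast, star_sum]
    congr 1
    refine Fintype.sum_equiv (Equiv.inv M) _ _ fun x => ?_
    simp only [Equiv.inv_apply]
    by_cases hc : c = T x c'
    · rw [if_pos hc, if_pos ((T_iff x c c').1 hc)]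
      -- The phase of the reversed move is the inverse of the phase of the move, which is its
      -- conjugate because it has modulus 1.
      have h1 : w x⁻¹ c * w x c' = 1 := by
        rw [hc, ← w_mul, inv_mul_cancel, w_one]
      have h2 := mul_star_self_of_norm (w_norm x c')
      exact mul_right_cancel₀ (norm_ne_zero_iff.1 (by rw [w_norm x c']; exact one_ne_zero))
        (h2.trans h1.symm)
    · rw [if_neg hc, if_neg (fun h => hc ((T_iff x c c').2 h)), star_zero]
  · ext a c
    -- The terms of the two averages compose to the term of `x * y`. For fixed `y` the sum over `x`
    -- is then a translate of one average, and the sum over `y` cancels one factor `1/|M|`.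
    have h1 : ∀ b, P a b * P b c = ((Fintype.card M : ℂ)⁻¹ * (Fintype.card M : ℂ)⁻¹) *
        ∑ y, ∑ x, if b = T y c then (if a = T (x * y) c then w (x * y) c else 0) else 0 := by
      intro b
      rw [hP, hP, mul_mul_mul_comm, Finset.sum_mul_sum, Finset.sum_comm]
      congr 1
      refine Finset.sum_congr rfl fun y _ => Finset.sum_congr rfl fun x _ => ?_
      by_cases hb : b = T y c
      · subst hb; simp [T_mul, w_mul]
      · simp [hb]
    have h2 : ∀ y, (∑ b, ∑ x, if b = T y c then
        (if a = T (x * y) c then w (x * y) c else 0) else 0) =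
          ∑ x, if a = T x c then w x c else 0 := by
      intro y
      rw [Finset.sum_comm]
      simp only [Finset.sum_ite_eq', Finset.mem_univ, if_true]
      exact Fintype.sum_equiv (Equiv.mulRight y) _ _ fun x => rfl
    rw [Matrix.mul_apply, Finset.sum_congr rfl fun b _ => h1 b, ← Finset.mul_sum, Finset.sum_comm,
      Finset.sum_congr rfl fun y _ => h2 y, hP, Finset.sum_const, Finset.card_univ, nsmul_eq_mul]
    field_simp
  · funext c'
    have h1 : ∀ x, (∑ c, (if c' = T x c then w x c else 0) * ψ c) = ψ c' := by
      intro x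
      rw [Finset.sum_eq_single (T x⁻¹ c')]
      · rw [if_pos (T_inv' x c').symm, hψ, T_inv']
      · intro c _ hc
        rw [if_neg (fun h => hc ((T_iff x c' c).1 h)), zero_mul]
      · simp
    simp only [mulVec, dotProduct, hP, mul_assoc, Finset.sum_mul, ← Finset.mul_sum]
    rw [Finset.sum_comm, Finset.sum_congr rfl fun x _ => h1 x, Finset.sum_const, Finset.card_univ,
      nsmul_eq_mul, inv_mul_cancel_left₀ hM]

/-- The average over the classes, all of size `m`, of an equivalence relation on the basis
labels, with phases. -/
lemma stabilizes_classAverage {r : C → C → Prop} [DecidableRel r] {w : C → C → ℂ}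
    {m : ℕ} {P : Matrix C C ℂ} {ψ : C → ℂ} (hP : ∀ c' c, P c' c = (m : ℂ)⁻¹ * if r c' c then w c' c else 0)
    (hr : Equivalence r) (hm : m ≠ 0)
    (hcard : ∀ c, (Finset.univ.filter fun c' => r c c').card = m)
    (w_norm : ∀ c' c, ‖w c' c‖ = 1)
    (w_mul : ∀ a b c, r a b → r b c → w a b * w b c = w a c)
    (hψ : ∀ c' c, r c' c → w c' c * ψ c = ψ c') : Stabilizes P ψ := by
  have hm' : (m : ℂ) ≠ 0 := Nat.cast_ne_zero.2 hm
  have hne : ∀ c' c, w c' c ≠ 0 := fun c' c =>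
    norm_ne_zero_iff.1 (by rw [w_norm]; exact one_ne_zero)
  have w_one : ∀ c, w c c = 1 := fun c =>
    mul_right_cancel₀ (hne c c) (by rw [w_mul c c c (hr.refl c) (hr.refl c), one_mul])
  refine ⟨?_, ?_, ?_⟩
  · ext c' c
    rw [conjTranspose_apply, hP, hP]
    simp only [star_mul', star_inv₀, star_natCast]
    congr 1
    by_cases hc : r c' c
    · rw [if_pos hc, if_pos (hr.symm hc)]
      refine mul_right_cancel₀ (hne c c') ((mul_star_self_of_norm (w_norm c c')).trans ?_)
      rw [w_mul _ _ _ hc (hr.symm hc), w_one]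
    · rw [if_neg hc, if_neg (fun h => hc (hr.symm h)), star_zero]
  · ext a c
    have h1 : ∀ b, P a b * P b c = if r a b then (m : ℂ)⁻¹ * P a c else 0 := by
      intro b
      by_cases hb : r a b
      · by_cases hc : r b c
        · rw [hP, hP, hP, if_pos hb, if_pos hc, if_pos hb, if_pos (hr.trans hb hc),
            ← w_mul a b c hb hc]
          ring
        · rw [hP b c, hP a c, if_neg hc, if_neg (fun h => hc (hr.trans (hr.symm hb) h))]
          simp
      · rw [hP a b, if_neg hb, if_neg hb]; simp
    rw [Matrix.mul_apply, Finset.sum_congr rfl fun b _ => h1 b, ← Finset.sum_filter,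
      Finset.sum_const, hcard, nsmul_eq_mul, mul_inv_cancel_left₀ hm']
  · funext a
    have h1 : ∀ b, P a b * ψ b = if r a b then (m : ℂ)⁻¹ * ψ a else 0 := by
      intro b
      by_cases hb : r a b
      · rw [hP, if_pos hb, if_pos hb, mul_assoc, hψ a b hb]
      · rw [hP, if_neg hb, if_neg hb]; simp
    rw [mulVec, dotProduct, Finset.sum_congr rfl fun b _ => h1 b, ← Finset.sum_filter,
      Finset.sum_const, hcard, nsmul_eq_mul, mul_inv_cancel_left₀ hm']

end GroundState

namespace TriangulatedSurface

/-! ### Gauged basis labels and their behaviour under local moves -/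

section Gauged

variable {V E F : Type*} (L : TriangulatedSurface V E F) {G : Type*} [Group G]
  {ω : G → G → G → Circle}

lemma eq_of_forall_edge {X : Type*} {g : V → X} (h : ∀ e, g (L.tgt e) = g (L.src e)) (v w : V) :
    g v = g w := by
  obtain ⟨γ⟩ := L.connected v w
  induction γ with
  | nil => rfl
  | forward e γ ih => rw [ih, h]
  | backward e γ ih => rw [ih, h]

lemma shift_inj {M : Type*} [Group M] (v : V) (x : M) {h h' : E → M} :
    L.shift v x h = L.shift v x h' ↔ h = h' :=
  ⟨fun e => by
    rw [← L.shift_one v h, ← L.shift_one v h', ← inv_mul_cancel x, L.shift_mul, L.shift_mul, e],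
    fun e => by rw [e]⟩

/-- Left multiplication by `x` at the vertex `v`. -/
def vertexMul (v : V) (x : G) : Equiv.Perm (V → G) where
  toFun g := Function.update g v (x * g v)
  invFun g := Function.update g v (x⁻¹ * g v)
  left_inv g := by simp
  right_inv g := by simp

lemma edgeRatio_one {M : Type*} [Group M] : L.edgeRatio (1 : V → M) = 1 := by
  funext e; simp [edgeRatio]

variable {K : Subgroup G} {σ : G ⧸ K → G}

lemma mul_normalPart (g : G) : σ (QuotientGroup.mk g) * normalPart K σ g = g := by
  simp [normalPart]

lemma normalPart_mem (hσ : ∀ q, QuotientGroup.mk (σ q) = q) (g : G) : normalPart K σ g ∈ K := by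
  rw [normalPart, ← QuotientGroup.eq, hσ]

lemma eq_mk_iff (hσ : ∀ q, QuotientGroup.mk (σ q) = q) (q : G ⧸ K) (g : G) :
    q = QuotientGroup.mk g ↔ (σ q)⁻¹ * g ∈ K := by
  rw [← QuotientGroup.eq, hσ]

/-- The basis label after gauging `K`. -/
def gauged (hσ : ∀ q, QuotientGroup.mk (σ q) = q) (g : V → G) : SetConfig V E K :=
  (fun v => QuotientGroup.mk (g v), fun e =>
    ⟨normalPart K σ (g (L.tgt e)) * (normalPart K σ (g (L.src e)))⁻¹,
      mul_mem (normalPart_mem hσ _) (inv_mem (normalPart_mem hσ _))⟩)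

lemma edgeLabel_inj {c c' : SetConfig V E K} (h1 : c.1 = c'.1)
    (h2 : L.edgeLabel K σ c = L.edgeLabel K σ c') : c = c' := by
  refine Prod.ext h1 (funext fun e => Subtype.ext ?_)
  have := congrFun h2 e
  simpa [edgeLabel, h1] using this

lemma edgeLabel_gauged (hσ : ∀ q, QuotientGroup.mk (σ q) = q) (g : V → G) :
    L.edgeLabel K σ (L.gauged hσ g) = L.edgeRatio g := by
  funext e
  simp only [edgeLabel, gauged, edgeRatio]
  rw [← mul_assoc, mul_normalPart, mul_assoc, ← _root_.mul_inv_rev, mul_normalPart]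

/-- The labels `q_i n_e q_j⁻¹` of a gauged configuration are simply `g_i g_j⁻¹`, and together with
the cosets they determine the configuration. This reduces partial gauging to full gauging with
cosets kept at the vertices. -/
lemma eq_gauged_iff (hσ : ∀ q, QuotientGroup.mk (σ q) = q) (g : V → G) (c : SetConfig V E K) :
    c = L.gauged hσ g ↔
      (∀ v, c.1 v = QuotientGroup.mk (g v)) ∧ L.edgeLabel K σ c = L.edgeRatio g :=
  ⟨fun h => by rw [h]; exact ⟨fun _ => rfl, L.edgeLabel_gauged hσ g⟩, fun h =>
    L.edgeLabel_inj (funext h.1) (by rw [h.2, L.edgeLabel_gauged hσ g])⟩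

/-- One formula serves both vertex terms: `A_v` is the case of an unchanged coset, `K_v` the case `n
= 1`. -/
lemma edgeLabel_update_shift (c : SetConfig V E K) (v : V) (q : G ⧸ K) (n : K) :
    L.edgeLabel K σ (Function.update c.1 v q, L.shift v n c.2) =
      L.shift v (σ q * n * (σ (c.1 v))⁻¹) (L.edgeLabel K σ c) := by
  funext e
  have := L.loopless e
  simp only [edgeLabel, shift]
  by_cases h1 : L.tgt e = v
  · subst h1; simp [Function.update_of_ne this, mul_assoc]
  · by_cases h2 : L.src e = v
    · subst h2; simp [h1, mul_assoc]
    · simp [h1, h2]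

variable [Fintype E] [Fintype F]

lemma spt_eq_of_edgeRatio_eq_one (hω : IsThreeCocycle ω) {g : V → G}
    (hg : L.edgeRatio g = 1) : L.spt ω g = L.spt ω 1 := by
  have h : ∀ v w, g v = g w := L.eq_of_forall_edge fun e => by
    simpa [edgeRatio, mul_inv_eq_one] using congrFun hg e
  rcases isEmpty_or_nonempty V with hV | ⟨⟨v⟩⟩
  · rw [Subsingleton.elim g 1]
  · rw [← L.spt_mul_right hω 1 (g v)]
    congr 1
    funext w
    simp [h w v]

variable [Fintype V] [Fintype G]

/-! ### The twisted quantum double -/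

lemma tqdState_apply (h : E → G) :
    L.tqdState ω h = ∑ g, if h = L.edgeRatio g then L.spt ω g else 0 := by
  simp only [tqdState, mulVec, dotProduct, gaugingMap, ite_mul, one_mul, zero_mul]
  refine Finset.sum_congr rfl fun g _ => ?_
  simp only [funext_iff, edgeRatio]

/-- No cancellation can occur at trivial edge labels: by connectedness the contributing
configurations are constant, and right translation gives them all the amplitude of the configuration
1. -/
lemma sum_ite_spt_ne_zero (hω : IsThreeCocycle ω) {p : (V → G) → Prop}
    [DecidablePred p] (h1 : p 1)
    (hp : ∀ g, p g → L.edgeRatio g = 1) : (∑ g, if p g then L.spt ω g else 0) ≠ 0 := by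
  have e : ∀ g, (if p g then L.spt ω g else 0) = if p g then L.spt ω 1 else 0 := by
    intro g
    by_cases hg : p g
    · rw [if_pos hg, if_pos hg, L.spt_eq_of_edgeRatio_eq_one hω (hp g hg)]
    · rw [if_neg hg, if_neg hg]
  rw [Finset.sum_congr rfl fun g _ => e g, ← Finset.sum_filter, Finset.sum_const, nsmul_eq_mul]
  refine mul_ne_zero (Nat.cast_ne_zero.2 (Finset.card_ne_zero_of_mem (a := 1) ?_))
    (L.spt_ne_zero _)
  simpa using h1

lemma tqdState_ne_zero (hω : IsThreeCocycle ω) : L.tqdState ω ≠ 0 := fun h =>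
  L.sum_ite_spt_ne_zero hω (p := fun g => 1 = L.edgeRatio g) L.edgeRatio_one.symm
    (fun _ hg => hg.symm) ((L.tqdState_apply 1).symm.trans (congrFun h 1))

/-- Left multiplication at `v` is a bijection between the vertex configurations over `h` and those
over its shift, and it changes each amplitude by the same phase. -/
lemma W_mul_tqdState (hω : IsThreeCocycle ω) (v : V) (x : G) (h : E → G) :
    L.W ω v x h * L.tqdState ω h = L.tqdState ω (L.shift v x h) := by
  rw [tqdState_apply, tqdState_apply, Finset.mul_sum]
  refine Fintype.sum_equiv (vertexMul v x) _ _ fun g => ?_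
  simp only [vertexMul, Equiv.coe_fn_mk, edgeRatio_update, shift_inj]
  by_cases hg : h = L.edgeRatio g
  · rw [if_pos hg, if_pos hg, L.spt_update hω, hg]
  · rw [if_neg hg, if_neg hg, mul_zero]

lemma stabilizes_tqdA (hω : IsThreeCocycle ω) (v : V) :
    Stabilizes (L.tqdA ω v) (L.tqdState ω) :=
  stabilizes_orbitAverage (T := fun x h => L.shift v x h) (w := fun x h => L.W ω v x h)
    (fun _ _ => rfl) (L.shift_one v) (L.shift_mul v) (L.norm_W v) (L.W_mul hω v)
    (L.W_mul_tqdState hω v)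

lemma stabilizes_tqdB (f : F) : Stabilizes (L.tqdB (G := G) f) (L.tqdState ω) := by
  refine stabilizes_diagonal_indicator (fun h : E → G => L.Flat h f) fun h hh => ?_
  rw [tqdState_apply] at hh
  obtain ⟨g, -, hg⟩ := Finset.exists_ne_zero_of_sum_ne_zero hh
  rw [(ite_ne_right_iff.1 hg).1]
  exact L.flat_edgeRatio g f

lemma isGroundState_tqdState (hω : IsThreeCocycle ω) :
    IsGroundState (L.tqdHamiltonian ω) (L.tqdState ω) := by
  refine AttainsBound.isGroundState ?_ (L.tqdState_ne_zero hω)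
    (E₀ := ∑ _ : V, -1 + ∑ _ : F, -1)
  rw [tqdHamiltonian, sub_eq_add_neg, ← Finset.sum_neg_distrib, ← Finset.sum_neg_distrib]
  exact (AttainsBound.sum _ fun v => (L.stabilizes_tqdA hω v).attainsBound_neg).add
    (AttainsBound.sum _ fun f => (L.stabilizes_tqdB f).attainsBound_neg)

/-! ### Gauged subgroups -/

omit [Fintype F] in
lemma subgroupGaugingMap_mulVec (hσ : ∀ q, QuotientGroup.mk (σ q) = q) (ψ : (V → G) → ℂ)
    (c : SetConfig V E K) :
    (L.subgroupGaugingMap K σ *ᵥ ψ) c = ∑ g, if c = L.gauged hσ g then ψ g else 0 := by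
  simp only [mulVec, dotProduct, subgroupGaugingMap, ite_mul, one_mul, zero_mul]
  refine Finset.sum_congr rfl fun g _ => ?_
  simp only [Prod.ext_iff, gauged, funext_iff, Subtype.ext_iff]

lemma W_mul_gauged (hω : IsThreeCocycle ω) (hσ : ∀ q, QuotientGroup.mk (σ q) = q)
    (c : SetConfig V E K) (v : V) (q : G ⧸ K) (n : K) :
    L.W ω v (σ q * n * (σ (c.1 v))⁻¹) (L.edgeLabel K σ c) *
        (L.subgroupGaugingMap K σ *ᵥ L.spt ω) c =
      (L.subgroupGaugingMap K σ *ᵥ L.spt ω) (Function.update c.1 v q, L.shift v n c.2) := by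
  rw [L.subgroupGaugingMap_mulVec hσ, L.subgroupGaugingMap_mulVec hσ, Finset.mul_sum]
  refine Fintype.sum_equiv (vertexMul v (σ q * n * (σ (c.1 v))⁻¹)) _ _ fun g => ?_
  simp only [vertexMul, Equiv.coe_fn_mk, eq_gauged_iff, edgeLabel_update_shift, edgeRatio_update,
    shift_inj]
  have hc : (∀ w, Function.update c.1 v q w = (QuotientGroup.mk (Function.update g v
      (σ q * n * (σ (c.1 v))⁻¹ * g v) w) : G ⧸ K)) ↔ ∀ w, c.1 w = QuotientGroup.mk (g w) := by
    refine forall_congr' fun w => ?_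
    by_cases hw : w = v
    · subst hw
      rw [Function.update_self, Function.update_self, eq_mk_iff hσ, eq_mk_iff hσ, mul_assoc,
        mul_assoc, inv_mul_cancel_left, K.mul_mem_cancel_left n.2]
    · rw [Function.update_of_ne hw, Function.update_of_ne hw]
  simp only [hc]
  by_cases hg : (∀ w, c.1 w = QuotientGroup.mk (g w)) ∧ L.edgeLabel K σ c = L.edgeRatio g
  · rw [if_pos hg, if_pos hg, L.spt_update hω, hg.2]
  · rw [if_neg hg, if_neg hg, mul_zero]

lemma gauged_ne_zero (hω : IsThreeCocycle ω) (hσ : ∀ q, QuotientGroup.mk (σ q) = q) :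
    L.subgroupGaugingMap K σ *ᵥ L.spt ω ≠ 0 := by
  intro h
  refine L.sum_ite_spt_ne_zero hω (p := fun g => L.gauged hσ 1 = L.gauged hσ g) rfl
    (fun g hg => ?_)
    ((L.subgroupGaugingMap_mulVec hσ _ _).symm.trans (congrFun h _))
  rw [← L.edgeLabel_gauged hσ, ← hg, L.edgeLabel_gauged, edgeRatio_one]

lemma stabilizes_setA (hω : IsThreeCocycle ω) (hσ : ∀ q, QuotientGroup.mk (σ q) = q) (v : V) :
    Stabilizes (L.setA ω K σ v) (L.subgroupGaugingMap K σ *ᵥ L.spt ω) := by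
  have key := fun (c : SetConfig V E K) (n : K) => L.edgeLabel_update_shift (σ := σ) c v (c.1 v) n
  have key' := fun (c : SetConfig V E K) (n : K) => L.W_mul_gauged hω hσ c v (c.1 v) n
  simp only [Function.update_eq_self] at key key'
  refine stabilizes_orbitAverage (M := K) (T := fun n (c : SetConfig V E K) => (c.1, L.shift v n c.2))
    (w := fun n (c : SetConfig V E K) => L.W ω v (σ (c.1 v) * n * (σ (c.1 v))⁻¹) (L.edgeLabel K σ c))
    (fun c' c => ?_) (fun c => ?_) (fun x y c => ?_) (fun x c => L.norm_W _ _ _)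
    (fun x y c => ?_) (fun x c => key' c x)
  · rw [setA]
    congr 1
    refine Finset.sum_congr rfl fun n _ => if_congr ?_ rfl rfl
    rw [Prod.ext_iff]
  · simp only [shift_one]
  · simp only [shift_mul]
  · simp only [key]
    rw [← L.W_mul hω]
    congr 1
    simp [mul_assoc]

lemma stabilizes_setB (hσ : ∀ q, QuotientGroup.mk (σ q) = q) (f : F) :
    Stabilizes (L.setB K f) (L.subgroupGaugingMap K σ *ᵥ L.spt ω) := by
  refine stabilizes_diagonal_indicator (fun c : SetConfig V E K => L.Flat c.2 f) fun c hc => ?_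
  rw [L.subgroupGaugingMap_mulVec hσ] at hc
  obtain ⟨g, -, hg⟩ := Finset.exists_ne_zero_of_sum_ne_zero hc
  have h := L.flat_edgeRatio g f
  rw [← L.edgeLabel_gauged hσ, ← (ite_ne_right_iff.1 hg).1] at h
  -- The coset representatives cancel around a triangle, so flatness of the `G`-valued labels is
  -- flatness of the `K`-valued ones.
  simp only [Flat, edgeLabel, src_bd_zero, tgt_bd_zero, src_bd_one, tgt_bd_one, src_bd_two,
    tgt_bd_two, mul_assoc, inv_mul_cancel_left, mul_right_inj] at h
  rw [← mul_assoc, mul_left_inj] at h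
  exact Subtype.ext h

/-- As `K` need not be normal, replacing the coset at `v` is treated as an equivalence relation with
classes of size `[G : K]` instead of a group action. The phases still compose, since `q''q'⁻¹ ·
q'q⁻¹ = q''q⁻¹`. -/
lemma stabilizes_setK (hω : IsThreeCocycle ω) (hσ : ∀ q, QuotientGroup.mk (σ q) = q) (v : V) :
    Stabilizes (L.setK ω K σ v) (L.subgroupGaugingMap K σ *ᵥ L.spt ω) := by
  have heq : ∀ c' c : SetConfig V E K, (∀ w, w ≠ v → c'.1 w = c.1 w) ∧ c'.2 = c.2 →
      c' = (Function.update c.1 v (c'.1 v), L.shift v 1 c.2) := by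
    rintro c' c ⟨h1, h2⟩
    refine Prod.ext (funext fun w => ?_) (by rw [shift_one, h2])
    by_cases hw : w = v
    · subst hw; simp
    · simp [hw, h1 w hw]
  have hlab : ∀ c' c : SetConfig V E K, (∀ w, w ≠ v → c'.1 w = c.1 w) ∧ c'.2 = c.2 →
      L.edgeLabel K σ c' =
        L.shift v (σ (c'.1 v) * (σ (c.1 v))⁻¹) (L.edgeLabel K σ c) := by
    intro c' c h
    rw [congrArg (L.edgeLabel K σ) (heq c' c h), edgeLabel_update_shift, OneMemClass.coe_one,
      mul_one]
  refine stabilizes_classAverage (m := Fintype.card (G ⧸ K))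
    (r := fun c' c : SetConfig V E K => (∀ w, w ≠ v → c'.1 w = c.1 w) ∧ c'.2 = c.2)
    (w := fun c' c : SetConfig V E K => L.W ω v (σ (c'.1 v) * (σ (c.1 v))⁻¹) (L.edgeLabel K σ c))
    (fun c' c => rfl) ⟨fun c => ⟨fun _ _ => rfl, rfl⟩, fun h => ⟨fun w hw => (h.1 w hw).symm,
      h.2.symm⟩, fun h h' => ⟨fun w hw => (h.1 w hw).trans (h'.1 w hw), h.2.trans h'.2⟩⟩
    Fintype.card_ne_zero (fun c => ?_) (fun c' c => L.norm_W _ _ _) (fun a b c hab hbc => ?_)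
    (fun c' c h => ?_)
  · rw [← Finset.card_univ, ← Finset.card_image_of_injective (Finset.univ : Finset (G ⧸ K))
      (f := fun q => ((Function.update c.1 v q, c.2) : SetConfig V E K)) fun q q' h => by
        simpa using congrFun (congrArg Prod.fst h) v]
    congr 1
    ext c'
    simp only [Finset.mem_filter, Finset.mem_univ, true_and, Finset.mem_image]
    constructor
    · rintro ⟨h1, h2⟩
      have := heq c' c ⟨fun w hw => (h1 w hw).symm, h2.symm⟩
      rw [shift_one] at this
      exact ⟨c'.1 v, this.symm⟩
    · rintro ⟨q, rfl⟩
      exact ⟨fun w hw => (Function.update_of_ne hw _ _).symm, rfl⟩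
  · rw [hlab b c hbc, ← L.W_mul hω]
    congr 1
    simp [mul_assoc]
  · have := L.W_mul_gauged hω hσ c v (c'.1 v) 1
    rwa [← heq c' c h, OneMemClass.coe_one, mul_one] at this

lemma isGroundState_gauged (hω : IsThreeCocycle ω) (hσ : ∀ q, QuotientGroup.mk (σ q) = q) :
    IsGroundState (L.setHamiltonian ω K σ) (L.subgroupGaugingMap K σ *ᵥ L.spt ω) := by
  refine AttainsBound.isGroundState ?_ (L.gauged_ne_zero hω hσ)
    (E₀ := ∑ _ : V, -1 + ∑ _ : F, -1 + ∑ _ : V, -1)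
  rw [setHamiltonian, sub_eq_add_neg, sub_eq_add_neg, ← Finset.sum_neg_distrib,
    ← Finset.sum_neg_distrib, ← Finset.sum_neg_distrib]
  exact ((AttainsBound.sum _ fun v => (L.stabilizes_setA hω hσ v).attainsBound_neg).add
    (AttainsBound.sum _ fun f => (L.stabilizes_setB hσ f).attainsBound_neg)).add
    (AttainsBound.sum _ fun v => (L.stabilizes_setK hω hσ v).attainsBound_neg)

/-- On gauged labels the operator is right translation of the underlying vertex labels by `x⁻¹`, so
the claim descends from the symmetry of the SPT state. -/
lemma symmetry_mulVec_gauged (hω : IsThreeCocycle ω) (hσ : ∀ q, QuotientGroup.mk (σ q) = q)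
    {x : G} (hx : x ∈ Subgroup.normalizer (K : Set G)) :
    L.symmetry K σ x *ᵥ (L.subgroupGaugingMap K σ *ᵥ L.spt ω) =
      L.subgroupGaugingMap K σ *ᵥ L.spt ω := by
  -- With `g = q n` one has `g x⁻¹ = (q x⁻¹)(x n x⁻¹)`, and the last factor lies in `K` because `x`
  -- normalises it.
  have hmk : ∀ g : G, (QuotientGroup.mk (σ (QuotientGroup.mk g) * x⁻¹) : G ⧸ K) =
      QuotientGroup.mk (g * x⁻¹) := fun g => by
    rw [QuotientGroup.eq]
    have := (Subgroup.mem_normalizer_iff.1 hx (normalPart K σ g)).1 (normalPart_mem hσ g)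
    simpa [normalPart, mul_assoc] using this
  have hs : ∀ (c' : SetConfig V E K) (g : V → G), L.symmetry K σ x c' (L.gauged hσ g) =
      if c' = L.gauged hσ (fun v => g v * x⁻¹) then 1 else 0 := by
    intro c' g
    rw [symmetry]
    refine if_congr ?_ rfl rfl
    rw [eq_gauged_iff]
    have h1 : (∀ v, c'.1 v = QuotientGroup.mk (σ ((L.gauged hσ g).1 v) * x⁻¹)) ↔
        ∀ v, c'.1 v = QuotientGroup.mk (g v * x⁻¹) :=
      forall_congr' fun v => ⟨fun h => h.trans (hmk _), fun h => h.trans (hmk _).symm⟩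
    rw [h1]
    refine and_congr_right fun hc => ?_
    rw [funext_iff]
    refine forall_congr' fun e => ?_
    have h2 : ∀ v, normalPart K σ (σ ((L.gauged hσ g).1 v) * x⁻¹) =
        (σ (c'.1 v))⁻¹ * (σ ((L.gauged hσ g).1 v) * x⁻¹) := fun v => by
      rw [normalPart, h1.2 hc v]
    have h3 := congrFun (L.edgeLabel_gauged hσ g) e
    have h4 : L.edgeRatio (fun v => g v * x⁻¹) e = L.edgeRatio g e := by simp [edgeRatio]
    rw [h4, ← h3, h2, h2, edgeLabel, edgeLabel]
    constructor
    · intro h; rw [h]; group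
    · intro h
      rw [mul_inv_eq_iff_eq_mul] at h
      rw [eq_inv_mul_of_mul_eq h]; group
  funext c'
  have h1 : ∀ c, L.symmetry K σ x c' c * (L.subgroupGaugingMap K σ *ᵥ L.spt ω) c =
      ∑ g, if c = L.gauged hσ g then
        (if c' = L.gauged hσ (fun v => g v * x⁻¹) then L.spt ω g else 0) else 0 := by
    intro c
    rw [L.subgroupGaugingMap_mulVec hσ, Finset.mul_sum]
    refine Finset.sum_congr rfl fun g _ => ?_
    by_cases hc : c = L.gauged hσ g
    · rw [hc, if_pos rfl, if_pos rfl, hs, ite_mul, one_mul, zero_mul]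
    · rw [if_neg hc, if_neg hc, mul_zero]
  rw [mulVec, dotProduct, Finset.sum_congr rfl fun c _ => h1 c, Finset.sum_comm,
    L.subgroupGaugingMap_mulVec hσ]
  simp only [Finset.sum_ite_eq', Finset.mem_univ, if_true]
  refine Fintype.sum_equiv (Equiv.piCongrRight fun _ => Equiv.mulRight x⁻¹) _ _ fun g => ?_
  refine if_congr Iff.rfl ?_ rfl
  exact (L.spt_mul_right hω g x⁻¹).symm

end Gauged

end TriangulatedSurface

/-! ## The procedure -/

namespace AbelianSeries.Embedding

variable {G : Type*} [Group G] {A : AbelianSeries G} (S : A.Embedding)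

lemma mk_cosetRep (k : ℕ) (c : G ⧸ A.sub k) : QuotientGroup.mk (S.cosetRep k c) = c := by
  conv_rhs => rw [← QuotientGroup.out_eq' c]
  rw [cosetRep, high, QuotientGroup.eq]
  simpa using S.low_mem k c.out

lemma normalPart_cosetRep {k : ℕ} (hk : k ≤ A.length) (g : G) :
    TriangulatedSurface.normalPart (A.sub k) (S.cosetRep k) g = S.low k g := by
  rw [TriangulatedSurface.normalPart, S.cosetRep_mk k hk, high]
  simp

end AbelianSeries.Embedding

namespace TriangulatedSurface

/-! ### Measurements, controlled shifts and correction strings on basis labels -/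

section Procedure

variable {V E F : Type*} (L : TriangulatedSurface V E F) {G : Type*} [Group G] [Fintype G]
  {ω : G → G → G → Circle} {A : AbelianSeries G} (S : A.Embedding)

/-- Matrix elements, at a single vertex, of the projector onto a Fourier state. -/
def projKernel (k : ℕ) (i : S.Charge k) (x y : G) : ℂ :=
  if ∀ j < A.length, j ≠ k → S.cls j x = S.cls j y then
    S.fourier k i x * star (S.fourier k i y) else 0

variable [Fintype V] [Fintype E]

omit [Fintype G] in
lemma proj_apply (k : ℕ) (v : V) (i : S.Charge k) (c' c : Config V E G) :
    proj S k v i c' c = if c'.2 = c.2 ∧ ∀ w, w ≠ v → c'.1 w = c.1 w then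
      projKernel S k i (c'.1 v) (c.1 v) else 0 := by
  simp only [proj, projKernel, ← and_assoc, ite_and]

lemma prod_proj_apply (k : ℕ) (p : V → S.Charge k) {l : List V} (hl : l.Nodup)
    (c' c : Config V E G) : (l.map fun v => proj S k v (p v)).prod c' c =
      if c'.2 = c.2 ∧ ∀ w, w ∉ l → c'.1 w = c.1 w then
        (l.map fun v => projKernel S k (p v) (c'.1 v) (c.1 v)).prod else 0 := by
  induction l generalizing c' with
  | nil => simp [Matrix.one_apply, Prod.ext_iff, funext_iff, and_comm]
  | cons a l ih =>
    obtain ⟨ha, hl⟩ := List.nodup_cons.1 hl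
    rw [List.map_cons, List.prod_cons, Matrix.mul_apply,
      -- The only contributing intermediate label: the projector at `a` has already replaced the
      -- value there, and the remaining ones leave that value alone.
      Finset.sum_eq_single (Function.update c'.1 a (c.1 a), c'.2)]
    · rw [proj_apply, ih hl, if_pos ⟨rfl, fun w hw => (Function.update_of_ne hw _ _).symm⟩,
        List.map_cons, List.prod_cons]
      simp only [Function.update_self]
      have h1 : (∀ w, w ∉ l → Function.update c'.1 a (c.1 a) w = c.1 w) ↔
          ∀ w, w ∉ a :: l → c'.1 w = c.1 w := by
        constructor
        · intro h w hw
          have := h w (fun h' => hw (List.mem_cons_of_mem _ h'))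
          rwa [Function.update_of_ne (fun h' => hw (by simp [h']))] at this
        · intro h w hw
          by_cases hwa : w = a
          · subst hwa; simp
          · rw [Function.update_of_ne hwa]
            exact h w (by simp [hwa, hw])
      have h2 : (l.map fun v => projKernel S k (p v) (Function.update c'.1 a (c.1 a) v) (c.1 v)) =
          l.map fun v => projKernel S k (p v) (c'.1 v) (c.1 v) :=
        List.map_congr_left fun v hv => by
          rw [Function.update_of_ne (fun h : v = a => ha (h ▸ hv))]
      simp only [h1, h2, mul_ite, mul_zero]
    · intro m _ hm
      rw [proj_apply, ih hl]
      by_cases h1 : c'.2 = m.2 ∧ ∀ w, w ≠ a → c'.1 w = m.1 w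
      · by_cases h2 : m.2 = c.2 ∧ ∀ w, w ∉ l → m.1 w = c.1 w
        · refine (hm (Prod.ext (funext fun w => ?_) h1.1.symm)).elim
          by_cases hw : w = a
          · subst hw; simp [h2.2 w ha]
          · simp [hw, h1.2 w hw]
        · rw [if_neg h2, mul_zero]
      · rw [if_neg h1, zero_mul]
    · simp

lemma measure_mulVec (k : ℕ) (p : V → S.Charge k) (ψ : Config V E G → ℂ) (g : V → G)
    (h : E → G) : (measure S k p *ᵥ ψ) (g, h) =
      ∑ u : V → G, (∏ v, projKernel S k (p v) (g v) (u v)) * ψ (u, h) := by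
  rw [mulVec, dotProduct, Fintype.sum_prod_type]
  refine Finset.sum_congr rfl fun u _ => ?_
  rw [Finset.sum_eq_single h]
  · rw [measure, prod_proj_apply S k p (Finset.nodup_toList _), if_pos (by simp),
      Finset.prod_map_toList]
  · intro h' _ hh
    rw [measure, prod_proj_apply S k p (Finset.nodup_toList _), if_neg (fun e => hh e.1.symm),
      zero_mul]
  · simp

lemma gate_mulVec (k : ℕ) (e : E) (ψ : Config V E G → ℂ) (g : V → G) (h : E → G) :
    (L.gate S k e *ᵥ ψ) (g, h) = ψ (g, Function.update h e
      ((S.digit k (g (L.tgt e)))⁻¹ * h e * S.digit k (g (L.src e)))) := by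
  rw [mulVec, dotProduct, Finset.sum_eq_single (g, Function.update h e
      ((S.digit k (g (L.tgt e)))⁻¹ * h e * S.digit k (g (L.src e))))]
  · rw [gate, if_pos, one_mul]
    simp [mul_assoc]
  · rintro ⟨g', h'⟩ _ hc
    rw [gate, if_neg, zero_mul]
    rintro ⟨h1, h2⟩
    dsimp only at h1 h2
    refine hc ?_
    rw [h2, ← h1]
    simp [mul_assoc]
  · simp

lemma entangle_mulVec (k : ℕ) (ψ : Config V E G → ℂ) (g : V → G) (h : E → G) :
    (L.entangle S k *ᵥ ψ) (g, h) =
      ψ (g, fun e => (S.digit k (g (L.tgt e)))⁻¹ * h e * S.digit k (g (L.src e))) := by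
  have key : ∀ (l : List E), l.Nodup → ∀ h : E → G, ((l.map (L.gate S k)).prod *ᵥ ψ) (g, h) =
      ψ (g, fun e => if e ∈ l then
        (S.digit k (g (L.tgt e)))⁻¹ * h e * S.digit k (g (L.src e)) else h e) := by
    intro l
    induction l with
    | nil => intro _ h; simp
    | cons a l ih =>
      intro hl h
      obtain ⟨ha, hl⟩ := List.nodup_cons.1 hl
      rw [List.map_cons, List.prod_cons, ← mulVec_mulVec, gate_mulVec, ih hl]
      congr 2
      funext e
      by_cases hea : e = a
      · subst hea; simp [ha]
      · simp [hea]
  rw [entangle, key _ (Finset.nodup_toList _)]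
  simp

/-- By the transmutation rule each edge of the path contributes the ratio of the phases at its ends,
and the product telescopes. The relation is required only on edge labels that come from a vertex
configuration. -/
lemma exists_zString_eq_diagonal (k : ℕ) (i : S.Charge k) {b v : V} (γ : L.EdgePath b v) :
    ∃ d : (E → G) → ℂ, (L.zString S k i γ : Matrix (Config V E G) (Config V E G) ℂ) =
        Matrix.diagonal (fun c => d c.2) ∧
      ∀ u : V → G, d (L.edgeRatio fun w => S.low (k + 1) (u w)) * S.zPhase k i (u b) =
        S.zPhase k i (u v) := by
  induction γ with
  | nil => exact ⟨1, by simp [zString], by simp⟩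
  | forward e γ ih =>
    obtain ⟨d, h1, h2⟩ := ih
    refine ⟨fun h => S.zPhase k i (h e) * d h, ?_, fun u => ?_⟩
    · rw [zString, h1, zEdge, diagonal_mul_diagonal]
    · rw [mul_assoc, h2, mul_comm]
      exact (S.zPhase_transmutation k i _ _).symm
  | backward e γ ih =>
    obtain ⟨d, h1, h2⟩ := ih
    refine ⟨fun h => S.zPhase k (-i) (h e) * d h, ?_, fun u => ?_⟩
    · rw [zString, h1, zEdge, diagonal_mul_diagonal]
    · rw [mul_assoc, h2, S.zPhase_neg, S.zPhase_transmutation k i (u (L.tgt e)) (u (L.src e)),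
        mul_comm]
      exact mul_inv_cancel_right₀ (S.zPhase_ne_zero _ _ _) _

lemma commute_zString (k k' : ℕ) (i : S.Charge k) (i' : S.Charge k') {b b' v v' : V}
    (γ : L.EdgePath b v) (γ' : L.EdgePath b' v') :
    Commute (L.zString S k i γ) (L.zString S k' i' γ') := by
  obtain ⟨d, h, -⟩ := L.exists_zString_eq_diagonal S k i γ
  obtain ⟨d', h', -⟩ := L.exists_zString_eq_diagonal S k' i' γ'
  rw [h, h']
  exact Matrix.commute_diagonal _ _

lemma prod_map_diagonal {ι C : Type*} [Fintype C] [DecidableEq C] (l : List ι) (f : ι → C → ℂ) :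
    (l.map fun i => Matrix.diagonal (f i)).prod =
      Matrix.diagonal fun c => (l.map fun i => f i c).prod := by
  induction l with
  | nil => simp
  | cons a l ih => simp [ih]

/-- All strings start at the same vertex `b`, so their contributions there combine into the phase of
the total charge. -/
lemma exists_correct_eq_diagonal (k : ℕ) (p : V → S.Charge k) {b : V} (γ : ∀ v, L.EdgePath b v) :
    ∃ d : (E → G) → ℂ, (L.correct S k p γ : Matrix (Config V E G) (Config V E G) ℂ) =
        Matrix.diagonal (fun c => d c.2) ∧
      ∀ u : V → G, d (L.edgeRatio fun w => S.low (k + 1) (u w)) * S.zPhase k (∑ v, p v) (u b) =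
        ∏ v, S.zPhase k (p v) (u v) := by
  choose d h1 h2 using fun v => L.exists_zString_eq_diagonal S k (p v) (γ v)
  refine ⟨fun h => ∏ v, d v h, ?_, fun u => ?_⟩
  · rw [correct]
    simp only [h1]
    rw [prod_map_diagonal]
    simp only [Finset.prod_map_toList]
  · rw [S.zPhase_sum, ← Finset.prod_mul_distrib]
    exact Finset.prod_congr rfl fun v _ => h2 v u

/-! ### Amplitudes of the gauged states and a single round -/

variable [Fintype F]

/-- The sum of the amplitudes `φ` over all vertex configurations in the cosets of `g` that produce
the edge labels `h` on gauging `G_k`. -/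
def gaugedSum (k : ℕ) (φ : (V → G) → ℂ) (g : V → G) (h : E → G) : ℂ :=
  ∑ u : V → G, if (∀ v, (QuotientGroup.mk (g v) : G ⧸ A.sub k) = QuotientGroup.mk (u v)) ∧
    h = L.edgeRatio (fun v => S.low k (u v)) then φ u else 0

/-- The explicit amplitude formula carried through the induction. No membership condition on `h` is
needed on the right, since ratios of parts in `G_k` lie in `G_k` automatically. -/
lemma withMeasured_setState {k : ℕ} (hk : k ≤ A.length) (p : ∀ k, V → S.Charge k) (g : V → G)
    (h : E → G) : withMeasured S k p (L.setState ω S k) (g, h) =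
      measured S k p g * L.gaugedSum S k (L.spt ω) g h := by
  rw [withMeasured]
  split_ifs with hh
  · congr 1
    rw [setState, mulVec, dotProduct, gaugedSum]
    refine Finset.sum_congr rfl fun u _ => ?_
    rw [subgroupGaugingMap, ite_mul, one_mul, zero_mul]
    refine if_congr (and_congr Iff.rfl ?_) rfl rfl
    simp only [S.normalPart_cosetRep hk, funext_iff, edgeRatio]
  · rw [gaugedSum, Finset.sum_eq_zero, mul_zero]
    intro u _
    rw [if_neg]
    rintro ⟨-, rfl⟩
    exact hh fun e => mul_mem (S.low_mem _ _) (inv_mem (S.low_mem _ _))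

lemma measured_ne_zero (k : ℕ) (p : ∀ k, V → S.Charge k) (g : V → G) :
    measured S k p g ≠ 0 :=
  Finset.prod_ne_zero_iff.2 fun _ _ => Finset.prod_ne_zero_iff.2 fun _ _ =>
    S.fourier_ne_zero _ _ _

omit [Fintype G] [Fintype E] [Fintype F] in
lemma measured_succ (k : ℕ) (p : ∀ k, V → S.Charge k) (g : V → G) :
    measured S (k + 1) p g = measured S k p g * ∏ v, S.fourier k (p k v) (g v) := by
  simp only [measured, Finset.prod_range_succ, Finset.prod_mul_distrib]

lemma withMeasured_setState_ne_zero (hω : IsThreeCocycle ω) {k : ℕ} (hk : k ≤ A.length)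
    (p : ∀ k, V → S.Charge k) : withMeasured S k p (L.setState ω S k) ≠ 0 := by
  intro h
  have h1 := congrFun h (1, 1)
  rw [withMeasured_setState L S hk] at h1
  refine mul_ne_zero (measured_ne_zero S k p 1) ?_ h1
  have hmem : ∀ u : V → G,
      (∀ v, (QuotientGroup.mk ((1 : V → G) v) : G ⧸ A.sub k) = QuotientGroup.mk (u v)) →
      (fun v => S.low k (u v)) = u := fun u hu => funext fun v => S.low_of_mem (by
    have := QuotientGroup.eq.1 (hu v)
    simpa using this)
  refine L.sum_ite_spt_ne_zero hω ⟨fun _ => rfl, ?_⟩ fun u hu => ?_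
  · rw [hmem 1 fun _ => rfl, edgeRatio_one]
  · rw [← hmem u hu.1, ← hu.2]

lemma initial_eq (p : ∀ k, V → S.Charge k) :
    L.initial ω = withMeasured S 0 p (L.setState ω S 0) := by
  funext ⟨g, h⟩
  have hlow : ∀ u : V → G, L.edgeRatio (fun v => S.low 0 (u v)) = 1 := by
    intro u
    rw [← L.edgeRatio_one]
    congr 1
    funext v
    have := S.low_mem 0 (u v)
    rwa [A.sub_zero, Subgroup.mem_bot] at this
  rw [withMeasured_setState L S (Nat.zero_le _), initial, measured, gaugedSum,
    Finset.sum_eq_single g]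
  · simp [hlow]
  · intro u _ hu
    rw [if_neg]
    rintro ⟨h1, -⟩
    refine hu (funext fun v => ?_)
    have := QuotientGroup.eq.1 (h1 v)
    rw [A.sub_zero, Subgroup.mem_bot, inv_mul_eq_one] at this
    exact this.symm
  · simp

/-- The state after a measurement, before it is corrected. -/
lemma measure_entangle_withMeasured {k : ℕ} (hk : k < A.length) (p : ∀ k, V → S.Charge k) :
    ∃ c : ℂ, c ≠ 0 ∧ ∀ (g : V → G) (h : E → G),
      (measure S k (p k) *ᵥ (L.entangle S k *ᵥ withMeasured S k p (L.setState ω S k))) (g, h) =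
        c * (measured S (k + 1) p g * L.gaugedSum S (k + 1)
          (fun u => (∏ v, star (S.zPhase k (p k v) (u v))) * L.spt ω u) g h) := by
  have hQ : (Real.sqrt (Nat.card (A.Q k)) : ℂ) ≠ 0 := by
    rw [Complex.ofReal_ne_zero, Real.sqrt_ne_zero (by positivity), Nat.cast_ne_zero]
    exact Nat.card_pos.ne'
  -- One normalisation factor per vertex, from the bra of the Fourier projector; the factor of the
  -- ket is absorbed in the measured states.
  refine ⟨∏ _v : V, (Real.sqrt (Nat.card (A.Q k)) : ℂ)⁻¹,
    Finset.prod_ne_zero_iff.2 fun _ _ => inv_ne_zero hQ, fun g h => ?_⟩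
  have hstar : ∀ u : V → G, ∏ v, star (S.fourier k (p k v) (u v)) =
      (∏ _v : V, (Real.sqrt (Nat.card (A.Q k)) : ℂ)⁻¹) *
        ∏ v, star (S.zPhase k (p k v) (u v)) := by
    intro u
    rw [← Finset.prod_mul_distrib]
    refine Finset.prod_congr rfl fun v _ => ?_
    rw [AbelianSeries.Embedding.fourier, star_div₀, div_eq_mul_inv, mul_comm]
    congr 2
    exact Complex.conj_ofReal _
  -- For given `g` and `u` a single intermediate `t` contributes: it takes its lower factors from
  -- `g` and the factor being measured, together with all higher ones, from `u`. The double sum thus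
  -- collapses to a sum over `u`.
  have term : ∀ t u : V → G, (∏ v, projKernel S k (p k v) (g v) (t v)) *
      (measured S k p t * if (∀ v, (QuotientGroup.mk (t v) : G ⧸ A.sub k) =
          QuotientGroup.mk (u v)) ∧ (fun e => (S.digit k (t (L.tgt e)))⁻¹ * h e *
            S.digit k (t (L.src e))) = L.edgeRatio (fun v => S.low k (u v)) then
        L.spt ω u else 0) =
      if t = fun v => u v * ((S.low k (u v))⁻¹ * S.low k (g v)) then
        (if (∀ v, (QuotientGroup.mk (g v) : G ⧸ A.sub (k + 1)) = QuotientGroup.mk (u v)) ∧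
          h = L.edgeRatio (fun v => S.low (k + 1) (u v)) then
          measured S (k + 1) p g * ((∏ v, star (S.fourier k (p k v) (u v))) * L.spt ω u)
        else 0) else 0 := by
    intro t u
    by_cases hR : ∀ v, (∀ j < A.length, j ≠ k → S.cls j (g v) = S.cls j (t v)) ∧
        (QuotientGroup.mk (t v) : G ⧸ A.sub k) = QuotientGroup.mk (u v)
    · have hR' := fun v => (S.cls_eq_and_mk_eq_iff hk (g v) (t v) (u v)).1 (hR v)
      have hd : ∀ v, S.digit k (t v) = S.digit k (u v) := fun v =>
        S.digit_eq_of_mk_eq hk (hR v).2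
      -- Undoing the controlled shifts removes the current factor from the part in `G_{k+1}` at both
      -- ends of each edge, leaving the part in `G_k`.
      have hedge : ((fun e => (S.digit k (t (L.tgt e)))⁻¹ * h e * S.digit k (t (L.src e))) =
          L.edgeRatio (fun v => S.low k (u v))) ↔
          h = L.edgeRatio (fun v => S.low (k + 1) (u v)) := by
        simp only [funext_iff, edgeRatio, hd, S.low_succ hk]
        refine forall_congr' fun e => ?_
        rw [← eq_mul_inv_iff_mul_eq, inv_mul_eq_iff_eq_mul, _root_.mul_inv_rev]
        simp only [mul_assoc]
      have hm : measured S k p t = measured S k p g :=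
        Finset.prod_congr rfl fun v _ => Finset.prod_congr rfl fun j hj =>
          S.fourier_congr j _ ((hR v).1 j ((Finset.mem_range.1 hj).trans hk)
            (Finset.mem_range.1 hj).ne).symm
      have hK : ∏ v, projKernel S k (p k v) (g v) (t v) = (∏ v, S.fourier k (p k v) (g v)) *
          ∏ v, star (S.fourier k (p k v) (u v)) := by
        rw [← Finset.prod_mul_distrib]
        refine Finset.prod_congr rfl fun v _ => ?_
        rw [projKernel, if_pos (hR v).1,
          S.fourier_congr k (p k v) (S.cls_eq_of_mk_eq le_rfl hk (hR v).2)]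
      rw [if_pos (funext fun v => (hR' v).2), hK, hm, measured_succ]
      by_cases he : h = L.edgeRatio (fun v => S.low (k + 1) (u v))
      · rw [if_pos ⟨fun v => (hR v).2, hedge.2 he⟩, if_pos ⟨fun v => (hR' v).1, he⟩]
        ring
      · rw [if_neg (fun h' => he (hedge.1 h'.2)), if_neg (fun h' => he h'.2)]
        simp
    · have hr : (if t = fun v => u v * ((S.low k (u v))⁻¹ * S.low k (g v)) then
        (if (∀ v, (QuotientGroup.mk (g v) : G ⧸ A.sub (k + 1)) = QuotientGroup.mk (u v)) ∧
          h = L.edgeRatio (fun v => S.low (k + 1) (u v)) then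
          measured S (k + 1) p g * ((∏ v, star (S.fourier k (p k v) (u v))) * L.spt ω u)
        else 0) else 0) = 0 := by
        by_cases ht : t = fun v => u v * ((S.low k (u v))⁻¹ * S.low k (g v))
        · rw [if_pos ht, if_neg]
          rintro ⟨h1, -⟩
          exact hR fun v =>
            (S.cls_eq_and_mk_eq_iff hk (g v) (t v) (u v)).2 ⟨h1 v, congrFun ht v⟩
        · rw [if_neg ht]
      rw [hr]
      by_cases h1 : ∀ v, (QuotientGroup.mk (t v) : G ⧸ A.sub k) = QuotientGroup.mk (u v)
      · obtain ⟨v, hv⟩ := not_forall.1 (fun h2 => hR fun v => ⟨h2 v, h1 v⟩)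
        rw [Finset.prod_eq_zero (Finset.mem_univ v) (by rw [projKernel, if_neg hv]), zero_mul]
      · rw [if_neg (fun h' => h1 h'.1), mul_zero, mul_zero]
  rw [measure_mulVec]
  simp only [entangle_mulVec, withMeasured_setState L S hk.le]
  simp only [gaugedSum, Finset.mul_sum]
  rw [Finset.sum_comm]
  refine Finset.sum_congr rfl fun u _ => ?_
  rw [Finset.sum_congr rfl fun t _ => term t u, Finset.sum_ite_eq', if_pos (Finset.mem_univ _)]
  split_ifs
  · rw [hstar]; ring
  · simp

/-- The global symmetry by `y ∈ G_{k+1}` maps the sum to itself times a phase determined by the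
total charge. A phase different from 1 forces the sum to vanish. -/
lemma gaugedSum_eq_zero (hω : IsThreeCocycle ω) {k : ℕ} (hk : k < A.length)
    {p : V → S.Charge k} (hp : ∑ v, p v ≠ 0) (g : V → G) (h : E → G) :
    L.gaugedSum S (k + 1) (fun u => (∏ v, star (S.zPhase k (p v) (u v))) * L.spt ω u) g h = 0 := by
  obtain ⟨y, hy, hy1⟩ := S.exists_zPhase_ne_one k hp
  set T := L.gaugedSum S (k + 1)
    (fun u => (∏ v, star (S.zPhase k (p v) (u v))) * L.spt ω u) g h with hT
  have key : star (S.zPhase k (∑ v, p v) y) * T = T := by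
    rw [hT, gaugedSum, Finset.mul_sum]
    refine Fintype.sum_equiv (Equiv.piCongrRight fun _ => Equiv.mulRight y) _ _ fun u => ?_
    rw [mul_ite, mul_zero]
    refine if_congr (and_congr (forall_congr' fun v => ?_) ?_) ?_ rfl
    · rw [show (QuotientGroup.mk (u v) : G ⧸ A.sub (k + 1)) = QuotientGroup.mk (u v * y) from
        (QuotientGroup.mk_mul_of_mem _ hy).symm]
      rfl
    · have : L.edgeRatio (fun v => S.low (k + 1) (u v)) =
          L.edgeRatio (fun v => S.low (k + 1) (u v * y)) := by
        funext e
        simp only [edgeRatio, S.low_mul hk _ hy]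
        group
      rw [this]
      rfl
    · have h1 : L.spt ω ((Equiv.piCongrRight fun _ => Equiv.mulRight y) u) = L.spt ω u :=
        L.spt_mul_right hω u y
      have h2 : ∏ v, star (S.zPhase k (p v) (((Equiv.piCongrRight fun _ => Equiv.mulRight y) u) v))
          = (∏ v, star (S.zPhase k (p v) (u v))) * star (S.zPhase k (∑ v, p v) y) := by
        rw [S.zPhase_sum, star_prod, ← Finset.prod_mul_distrib]
        refine Finset.prod_congr rfl fun v _ => ?_
        rw [← star_mul', ← S.zPhase_mul hk _ _ hy]
        rfl
      rw [h1, h2]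
      ring
  by_contra hne
  refine hy1 (star_injective ?_)
  rw [star_one]
  exact mul_right_cancel₀ hne (by rw [key, one_mul])

lemma correct_measure_entangle {k : ℕ} (hk : k < A.length) (p : ∀ k, V → S.Charge k)
    (hp : ∑ v, p k v = 0) {b : V} (γ : ∀ v, L.EdgePath b v) :
    ∃ c : ℂ, c ≠ 0 ∧ L.correct S k (p k) γ *ᵥ (measure S k (p k) *ᵥ (L.entangle S k *ᵥ
      withMeasured S k p (L.setState ω S k))) =
        c • withMeasured S (k + 1) p (L.setState ω S (k + 1)) := by
  obtain ⟨c, hc, hm⟩ := L.measure_entangle_withMeasured (ω := ω) S hk p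
  obtain ⟨d, hd1, hd2⟩ := L.exists_correct_eq_diagonal S k (p k) γ
  refine ⟨c, hc, funext fun ⟨g, h⟩ => ?_⟩
  rw [hd1, mulVec_diagonal, hm, Pi.smul_apply, smul_eq_mul, withMeasured_setState L S hk,
    mul_left_comm, mul_left_comm (d h)]
  congr 2
  rw [gaugedSum, gaugedSum, Finset.mul_sum]
  refine Finset.sum_congr rfl fun u _ => ?_
  rw [mul_ite, mul_zero]
  by_cases hu : (∀ v, (QuotientGroup.mk (g v) : G ⧸ A.sub (k + 1)) = QuotientGroup.mk (u v)) ∧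
      h = L.edgeRatio (fun v => S.low (k + 1) (u v))
  · have h1 := hd2 u
    rw [hp, S.zPhase_zero, mul_one, ← hu.2] at h1
    -- On every contributing `u` the strings give `∏ z^{p_v}(u_v)`, the inverse of the conjugate
    -- phases left by the measurement.
    rw [if_pos hu, if_pos hu, h1, ← mul_assoc, ← Finset.prod_mul_distrib,
      Finset.prod_eq_one fun v _ => ?_, one_mul]
    rw [S.star_zPhase, mul_inv_cancel₀ (S.zPhase_ne_zero _ _ _)]
  · rw [if_neg hu, if_neg hu]

/-! ### Induction over the rounds and the global charge constraint -/

variable (p : ∀ k, V → S.Charge k) {b : ℕ → V} (γ : ∀ k v, L.EdgePath (b k) v)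

lemma run_eq_smul_withMeasured {k : ℕ} (hk : k ≤ A.length) (hp : ∀ j < k, ∑ v, p j v = 0) :
    ∃ c : ℂ, c ≠ 0 ∧ L.run ω S p γ k = c • withMeasured S k p (L.setState ω S k) := by
  induction k with
  | zero => exact ⟨1, one_ne_zero, by rw [one_smul, ← L.initial_eq S p]; rfl⟩
  | succ k ih =>
    obtain ⟨c, hc, h⟩ := ih (by omega) fun j hj => hp j (by omega)
    obtain ⟨c', hc', h'⟩ := L.correct_measure_entangle (ω := ω) S hk p (hp k (by omega)) (γ k)
    refine ⟨c * c', mul_ne_zero hc hc', ?_⟩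
    rw [run, h, mulVec_smul, mulVec_smul, mulVec_smul, h', smul_smul]

lemma run_succ (k : ℕ) :
    L.run ω S p γ (k + 1) = L.correct S k (p k) (γ k) *ᵥ L.postMeasure ω S p γ k := rfl

lemma postMeasure_eq_zero (hω : IsThreeCocycle ω) {k : ℕ} (hk : k < A.length)
    (hp : ¬ ∀ j ≤ k, ∑ v, p j v = 0) : L.postMeasure ω S p γ k = 0 := by
  induction k with
  | zero =>
    obtain ⟨c, -, h⟩ := L.run_eq_smul_withMeasured (ω := ω) S p γ hk.le (by simp)
    obtain ⟨c', -, h'⟩ := L.measure_entangle_withMeasured (ω := ω) S hk p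
    funext ⟨g, e⟩
    rw [postMeasure, h, mulVec_smul, mulVec_smul, Pi.smul_apply, h',
      L.gaugedSum_eq_zero S hω hk (by simpa using hp)]
    simp
  | succ k ih =>
    by_cases hk' : ∀ j ≤ k, ∑ v, p j v = 0
    · have hne : ∑ v, p (k + 1) v ≠ 0 := fun h0 => hp fun j hj => by
        rcases Nat.lt_or_ge k j with h1 | h1
        · rwa [show j = k + 1 by omega]
        · exact hk' j h1
      obtain ⟨c, -, h⟩ := L.run_eq_smul_withMeasured (ω := ω) S p γ hk.le
        fun j hj => hk' j (by omega)
      obtain ⟨c', -, h'⟩ := L.measure_entangle_withMeasured (ω := ω) S hk p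
      funext ⟨g, e⟩
      rw [postMeasure, h, mulVec_smul, mulVec_smul, Pi.smul_apply, h',
        L.gaugedSum_eq_zero S hω hk hne]
      simp
    -- A violated constraint in an earlier round has already made the state zero, and linear
    -- operators keep it zero.
    · rw [postMeasure, run_succ, ih (by omega) hk']
      simp

lemma postMeasure_ne_zero_iff (hω : IsThreeCocycle ω) {k : ℕ} (hk : k < A.length) :
    L.postMeasure ω S p γ k ≠ 0 ↔ ∀ j ≤ k, ∑ v, p j v = 0 := by
  constructor
  · intro h
    by_contra hp
    exact h (L.postMeasure_eq_zero S p γ hω hk hp)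
  · intro hp h
    -- A zero state after the measurement would stay zero after the correction, whereas the
    -- corrected state is a nonzero multiple of a nonzero state.
    obtain ⟨c, hc, h'⟩ := L.run_eq_smul_withMeasured (ω := ω) S p γ (k := k + 1) hk
      fun j hj => hp j (by omega)
    rw [run_succ, h, mulVec_zero] at h'
    exact smul_ne_zero hc (L.withMeasured_setState_ne_zero S hω hk p) h'.symm

/-- At the last stage `G_N = G`: there is one coset, and the part of an element in `G_N` is the
element itself. The sum therefore no longer depends on the vertex labels. -/
lemma withMeasured_length : withMeasured S A.length p (L.setState ω S A.length) =
    fun x : (V → G) × (E → G) => measured S A.length p x.1 * L.tqdState ω x.2 := by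
  funext ⟨g, h⟩
  rw [withMeasured_setState L S le_rfl]
  congr 1
  rw [tqdState_apply, gaugedSum]
  refine Finset.sum_congr rfl fun u _ => if_congr ?_ rfl rfl
  simp only [S.low_length]
  refine and_iff_right fun v => ?_
  rw [QuotientGroup.eq, A.sub_length]
  trivial

end Procedure

end TriangulatedSurface

end

theorem mainTheorem4 {G : Type*} [Group G] [Fintype G] [Group.IsSolvable G]
    {V E F : Type*} [Fintype V] [Fintype E] [Fintype F]
    (L : TriangulatedSurface V E F) (ω : G → G → G → Circle) (hω : IsThreeCocycle ω) :
    -- the input of the procedure exists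
    Nonempty (AbelianSeries G) ∧
    ∀ A : AbelianSeries G, Nonempty A.Embedding ∧ ∀ S : A.Embedding,
      -- transmutation rules
      (∀ k < A.length, ∀ (i : S.Charge k) (g h : G),
        S.zPhase k i g = S.zPhase k i h * S.zPhase k i (S.low (k + 1) g * (S.low (k + 1) h)⁻¹)) ∧
      -- the correction operators commute
      (∀ (k k' : ℕ) (i : S.Charge k) (i' : S.Charge k') (b b' v v' : V)
        (γ : L.EdgePath b v) (γ' : L.EdgePath b' v'),
        Commute (L.zString S k i γ) (L.zString S k' i' γ')) ∧
      -- outcomes of the measurements and states after every round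
      (∀ (p : ∀ k, V → S.Charge k) (b : ℕ → V) (γ : ∀ k v, L.EdgePath (b k) v),
        (∀ k < A.length, L.postMeasure ω S p γ k ≠ 0 ↔ ∀ j ≤ k, ∑ v, p j v = 0) ∧
        (∀ k ≤ A.length, (∀ j < k, ∑ v, p j v = 0) → ∃ c : ℂ, c ≠ 0 ∧
          L.run ω S p γ k =
            c • TriangulatedSurface.withMeasured S k p (L.setState ω S k)) ∧
        ((∀ j < A.length, ∑ v, p j v = 0) → ∃ c : ℂ, c ≠ 0 ∧
          L.run ω S p γ A.length = c • fun x : (V → G) × (E → G) =>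
            TriangulatedSurface.measured S A.length p x.1 * L.tqdState ω x.2)) ∧
      -- the intermediate states are ground states with the remaining global symmetry
      (∀ k ≤ A.length,
        IsGroundState (L.setHamiltonian ω (A.sub k) (S.cosetRep k)) (L.setState ω S k) ∧
        ∀ x ∈ Subgroup.normalizer (A.sub k : Set G),
          L.symmetry (A.sub k) (S.cosetRep k) x *ᵥ L.setState ω S k = L.setState ω S k) ∧
      -- the final state is a ground state of the twisted quantum double
      IsGroundState (L.tqdHamiltonian ω) (L.tqdState ω) := by
  refine ⟨AbelianSeries.nonempty_of_isSolvable G, fun A => ⟨A.nonempty_embedding, fun S =>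
    ⟨fun k _ => S.zPhase_transmutation k, fun k k' i i' _ _ _ _ => L.commute_zString S k k' i i',
      fun p b γ => ⟨fun k hk => L.postMeasure_ne_zero_iff S p γ hω hk,
        fun k hk hp => L.run_eq_smul_withMeasured S p γ hk hp, fun hp => ?_⟩,
      fun k _ => ⟨L.isGroundState_gauged hω (S.mk_cosetRep k), fun x hx =>
        L.symmetry_mulVec_gauged hω (S.mk_cosetRep k) hx⟩, L.isGroundState_tqdState hω⟩⟩⟩
  obtain ⟨c, hc, h⟩ := L.run_eq_smul_withMeasured (ω := ω) S p γ le_rfl hp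
  exact ⟨c, hc, by rw [h, L.withMeasured_length]⟩
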